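/- Let $K$ be a field of characteristic different from $2$ and let $d\in K$ with $d(d-1)\neq 0$. Let $E$ be the Edwards curve $x^2+y^2=1+d\,x^2y^2$ over $K$, taken as the projective plane curve $X^2Z^2+Y^2Z^2=Z^4+dX^2Y^2$, with points at infinity $\Omega_1=[Z:X:Y]=[0:1:0]$ and $\Omega_2=[0:0:1]$. Divisors on $E$ are finite $\mathbb Z$-linear combinations of closed points of $E$, a closed point counting with the degree of its residue field over $K$. The order of a nonzero rational function $a/b$ (with $a,b\in\mathcal O_{E,P}$) at $P$ is $\operatorname{length}(\mathcal O_{E,P}/a)-\operatorname{length}(\mathcal O_{E,P}/b)$; these orders define principal divisors and linear equivalence $\equiv$. Let $J(E)$ be the group of divisors of degree $0$ modulo principal divisors. Put $O=(0,1)$, $O'=(0,-1)$, $H=(1,0)$, $H'=(-1,0)$. 1. For every divisor $D$ of degree $0$ on $E$ there is an affine point $P\in E(K)$ such that one of the following holds: $D\equiv P-O$; $D\equiv (P-O)+(\Omega_1-O)$; $D\equiv (P-O)+(\Omega_2-O)$; $D\equiv (P-O)+(\Omega_1-\Omega_2)$. 2. If $d$ is not a square in $K$, the classes of the divisors $P-O$,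 with $P\in E(K)$ affine, form a subgroup $J_0(E)$ of $J(E)$ of index $4$, and $J(E)/J_0(E)\cong \mathbb Z/2\mathbb Z\oplus\mathbb Z/2\mathbb Z$. 3. $2\Omega_1\equiv O'+O$ and $2\Omega_2\equiv H'+H$. -/

import Mathlib

noncomputable section

namespace Edwards

open MvPolynomial

variable {K : Type*} [Field K]

/-- The form `X²Z² + Y²Z² - Z⁴ - d X²Y²` in the coordinates `[Z : X : Y] = [X 0 : X 1 : X 2]`.
Its zero locus in the projective plane is the Edwards curve `x² + y² = 1 + d x² y²`. -/
def form (d : K) : MvPolynomial (Fin 3) K :=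
  X 1 ^ 2 * X 0 ^ 2 + X 2 ^ 2 * X 0 ^ 2 - X 0 ^ 4 - C d * X 1 ^ 2 * X 2 ^ 2

/-- Dehomogenization: the `i`-th homogeneous coordinate is set to `1`, and the other two, in
order, become the two affine coordinates of the `i`-th standard chart. -/
def dehom (i : Fin 3) : MvPolynomial (Fin 3) K →ₐ[K] MvPolynomial (Fin 2) K :=
  aeval (i.insertNth (1 : MvPolynomial (Fin 2) K) X)

/-- The coordinate ring of the curve in the `i`-th standard chart of the projective plane.
Chart `0` is the affine Edwards curve, with coordinates `(x, y)`. -/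
abbrev Chart (d : K) (i : Fin 3) : Type _ :=
  MvPolynomial (Fin 2) K ⧸ Ideal.span {dehom i (form d)}

/-- Evaluation of functions on the `i`-th chart at a `K`-rational point `p` of that chart. -/
def evalAt (d : K) (i : Fin 3) (p : Fin 2 → K) (hp : aeval p (dehom i (form d)) = 0) :
    Chart d i →ₐ[K] K :=
  Ideal.Quotient.liftₐ _ (aeval p) (by
    intro a ha
    obtain ⟨b, rfl⟩ := Ideal.mem_span_singleton.1 ha
    rw [map_mul, hp, zero_mul])

/-- The maximal ideal of functions on the `i`-th chart that vanish at the rational point `p`. -/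
def idealAt (d : K) (i : Fin 3) (p : Fin 2 → K) (hp : aeval p (dehom i (form d)) = 0) :
    Ideal (Chart d i) :=
  RingHom.ker (evalAt d i p hp)

theorem idealAt_isMaximal (d : K) (i : Fin 3) (p : Fin 2 → K)
    (hp : aeval p (dehom i (form d)) = 0) : (idealAt d i p hp).IsMaximal :=
  RingHom.ker_isMaximal_of_surjective _ fun c =>
    ⟨algebraMap K _ c, (evalAt d i p hp).commutes c⟩

theorem origin_one (d : K) : aeval (0 : Fin 2 → K) (dehom 1 (form d)) = 0 := by
  have h : (Fin.insertNth (1 : Fin 3) (1 : MvPolynomial (Fin 2) K) X : Fin 3 → _) 2 = X 1 := rfl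
  have h' : (Fin.insertNth (1 : Fin 3) (1 : MvPolynomial (Fin 2) K) X : Fin 3 → _) 0 = X 0 := rfl
  simp [form, dehom, h, h']

theorem origin_two (d : K) : aeval (0 : Fin 2 → K) (dehom 2 (form d)) = 0 := by
  have h : (Fin.insertNth (2 : Fin 3) (1 : MvPolynomial (Fin 2) K) X : Fin 3 → _) 1 = X 1 := rfl
  have h' : (Fin.insertNth (2 : Fin 3) (1 : MvPolynomial (Fin 2) K) X : Fin 3 → _) 0 = X 0 := rfl
  simp [form, dehom, h, h']

/-- The closed points of the projective Edwards curve over `K`: those of the affine curve, and the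
points on the line `Z = 0`. On that line the form is `-d X² Y²`, so for `d ≠ 0` these are exactly
`Ω₁ = [0 : 1 : 0]` and `Ω₂ = [0 : 0 : 1]`. -/
inductive ClosedPoint (d : K) : Type _
  | affine (m : MaximalSpectrum (Chart d 0)) : ClosedPoint d
  | omega1 : ClosedPoint d
  | omega2 : ClosedPoint d

namespace ClosedPoint

variable {d : K}

/-- A standard chart containing the given closed point. -/
def chart : ClosedPoint d → Fin 3
  | affine _ => 0
  | omega1 => 1
  | omega2 => 2

/-- The maximal ideal of a closed point; `Ω₁` and `Ω₂` are the origins of their charts. -/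
def ideal : (P : ClosedPoint d) → Ideal (Chart d P.chart)
  | affine m => m.asIdeal
  | omega1 => idealAt d 1 0 (origin_one d)
  | omega2 => idealAt d 2 0 (origin_two d)

instance ideal_isMaximal : (P : ClosedPoint d) → P.ideal.IsMaximal
  | affine m => m.isMaximal
  | omega1 => idealAt_isMaximal d 1 0 (origin_one d)
  | omega2 => idealAt_isMaximal d 2 0 (origin_two d)

/-- The local ring of the curve at a closed point. -/
abbrev LocalRing (P : ClosedPoint d) : Type _ := Localization.AtPrime P.ideal

/-- The degree `[κ(P) : K]` of a closed point. -/
def degree (P : ClosedPoint d) : ℕ := Module.finrank K (Chart d P.chart ⧸ P.ideal)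

/-- The order at `P` of the restriction to the curve of a form `G`: the length of `𝓞_P / (g)`,
with `g` the dehomogenization of `G` (so, times the degree of `P`, this is the intersection
multiplicity at `P` of the curve with `G = 0`). -/
def order (P : ClosedPoint d) (G : MvPolynomial (Fin 3) K) : ℕ∞ :=
  Ring.ord P.LocalRing
    (algebraMap (Chart d P.chart) P.LocalRing (Ideal.Quotient.mk _ (dehom P.chart G)))

end ClosedPoint

/-- Divisors on the projective Edwards curve. -/
abbrev Divisor (d : K) : Type _ := ClosedPoint d →₀ ℤ

/-- The degree of a divisor. -/
def Divisor.degree (d : K) : Divisor d →+ ℤ :=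
  Finsupp.liftAddHom fun P => (AddMonoidHom.mulRight (P.degree : ℤ))

/-- Divisors of degree zero. -/
def Div0 (d : K) : AddSubgroup (Divisor d) := (Divisor.degree d).ker

/-- `D` is the divisor of a nonzero rational function, i.e. of the restriction to the curve of a
quotient `G / H` of forms of the same degree, neither of which vanishes on the curve. -/
def IsDivisorOfFunction {d : K} (D : Divisor d) : Prop :=
  ∃ (n : ℕ) (G H : MvPolynomial (Fin 3) K), G.IsHomogeneous n ∧ H.IsHomogeneous n ∧
    ¬ form d ∣ G ∧ ¬ form d ∣ H ∧
    ∀ P : ClosedPoint d, D P = ((P.order G).toNat : ℤ) - ((P.order H).toNat : ℤ)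

/-- The subgroup of principal divisors: the divisors of nonzero rational functions.
(On an integral curve these already form a subgroup.) -/
def Princ (d : K) : AddSubgroup (Divisor d) :=
  AddSubgroup.closure {D | IsDivisorOfFunction D}

/-- Linear equivalence of divisors. -/
def LinEquiv {d : K} (D D' : Divisor d) : Prop := D - D' ∈ Princ d

/-- The group of divisor classes of degree zero. -/
abbrev Jac (d : K) : Type _ := Div0 d ⧸ (Princ d).addSubgroupOf (Div0 d)

/-- The affine (`K`-rational) points of the Edwards curve. -/
@[ext]
structure AffinePoint (d : K) where
  x : K
  y : K
  equation : x ^ 2 + y ^ 2 = 1 + d * x ^ 2 * y ^ 2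

namespace AffinePoint

variable {d : K}

theorem aeval_eq_zero (P : AffinePoint d) : aeval ![P.x, P.y] (dehom 0 (form d)) = 0 := by
  have h1 : (Fin.insertNth (0 : Fin 3) (1 : MvPolynomial (Fin 2) K) X : Fin 3 → _) 1 = X 0 := rfl
  have h2 : (Fin.insertNth (0 : Fin 3) (1 : MvPolynomial (Fin 2) K) X : Fin 3 → _) 2 = X 1 := rfl
  have h := P.equation
  simp only [form, dehom, map_sub, map_add, map_mul, map_pow, aeval_X, algHom_C, h1, h2,
    Fin.insertNth_apply_same, map_one, algebraMap_eq]
  simp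
  linear_combination h

/-- The closed point given by an affine `K`-rational point. -/
def toClosedPoint (P : AffinePoint d) : ClosedPoint d :=
  .affine ⟨idealAt d 0 ![P.x, P.y] P.aeval_eq_zero, idealAt_isMaximal _ _ _ _⟩

/-- An affine `K`-rational point as a divisor. -/
def toDivisor (P : AffinePoint d) : Divisor d := Finsupp.single P.toClosedPoint 1

end AffinePoint

/-- The point `O = (0, 1)`. -/
def ptO (d : K) : AffinePoint d := ⟨0, 1, by simp⟩

/-- The point `O' = (0, -1)`. -/
def ptO' (d : K) : AffinePoint d := ⟨0, -1, by simp⟩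

/-- The point `H = (1, 0)`. -/
def ptH (d : K) : AffinePoint d := ⟨1, 0, by simp⟩

/-- The point `H' = (-1, 0)`. -/
def ptH' (d : K) : AffinePoint d := ⟨-1, 0, by simp⟩

/-- The point at infinity `Ω₁ = [0 : 1 : 0]` as a divisor. -/
def divOmega1 (d : K) : Divisor d := Finsupp.single .omega1 1

/-- The point at infinity `Ω₂ = [0 : 0 : 1]` as a divisor. -/
def divOmega2 (d : K) : Divisor d := Finsupp.single .omega2 1

theorem finrank_quotient_idealAt (d : K) (i : Fin 3) (p : Fin 2 → K)
    (hp : aeval p (dehom i (form d)) = 0) :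
    Module.finrank K (Chart d i ⧸ idealAt d i p hp) = 1 := by
  have e := Ideal.quotientKerAlgEquivOfSurjective (f := evalAt d i p hp)
    fun c => ⟨algebraMap K _ c, (evalAt d i p hp).commutes c⟩
  exact e.toLinearEquiv.finrank_eq.trans (Module.finrank_self K)

theorem degree_toDivisor {d : K} (P : AffinePoint d) : Divisor.degree d P.toDivisor = 1 := by
  have h : P.toClosedPoint.degree = 1 := finrank_quotient_idealAt _ _ _ P.aeval_eq_zero
  simp [Divisor.degree, AffinePoint.toDivisor, h]

theorem sub_mem_Div0 {d : K} (P Q : AffinePoint d) : P.toDivisor - Q.toDivisor ∈ Div0 d := by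
  simp [Div0, AddMonoidHom.mem_ker, degree_toDivisor]

/-- The class of `P - O`. -/
def classOf {d : K} (P : AffinePoint d) : Jac d :=
  QuotientAddGroup.mk ⟨P.toDivisor - (ptO d).toDivisor, sub_mem_Div0 P (ptO d)⟩

end Edwards

end

/-!
The point of the proof is that the affine Edwards curve is regular, while the two points at infinity
are nodes, so that a Riemann–Roch argument on the coordinate ring `R` of the affine curve reduces
divisors to rational points, and an argument on the nodes distinguishes the reduced divisors.

On the affine curve `1 - d x²` is a unit of `R`, so up to units every function is `A(x) + B(x) y`, and
its norm to `K[x]` is nonzero because `(1 - x²)(1 - d x²)` is not a square. This makes `R` a Dedekind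
domain (`exists_local_generator`): effective divisors on the affine curve are nonzero ideals `I`, of
degree `dim (R / I)` (`degree_idealDiv`). At `Ω₁` and `Ω₂` the local ring has a maximal ideal
`m = (z, w)` with `z² = v w²` and `v ≡ d` modulo `m` (`isNode_originRing`). Hence `m² = w m`, every
element of `m` has order at least `2`, and `w` has order exactly `2`.

For the forms `A Z + B Y` with `A` and `B` binary forms in `X` and `Z`, Bézout's theorem
(`hasBezout_mixedForm`) follows by multiplying the form with its conjugates under changes of sign of
the coordinates, until forms in `X²` and `Z²` remain, whose zeros can be counted directly. Such a form
with `A` and `B` of degree `a` has degree `a + 1`, order at least `2` at `Ω₁` and at least `2 a` at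
`Ω₂`, so the function `A(x) + B(x) y` has at most `2 a + 2` zeros on the affine curve. An ideal of odd
codimension `2 a + 1` contains such a function, since these have `2 a + 2` coefficients; the residual
zero, if there is one, is a rational point. So modulo `Ω₁` and `Ω₂` every effective divisor of odd
degree is zero or a rational point (`cl_idealDiv_of_odd`).

The functions `x - x₀` and `y - y₀` give `(x, y) + (x, -y) ≡ 2 Ω₁` and `(x, y) + (-x, y) ≡ 2 Ω₂`
(`pt_add_pt_negY`, `pt_add_pt_negX`), of which the third part is a special case. They imply that
`2 Ω₂ - 2 Ω₁` can be absorbed into a rational point, which leaves the four kinds of divisors of the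
first part (`isReducedClass_of_mem_Div0`).

If `d` is not a square, the two branches `z = ± √d w` of each node are conjugate over `K`, so every
order at `Ω₁` or `Ω₂` is even (`IsNode.even_ord`). The parities of the coefficients at `Ω₁` and `Ω₂`
therefore define a surjection of `J(E)` onto `(ℤ / 2)²`, and by the first part its kernel consists of
the classes of `P - O` (`mem_ker_parityJac`).
-/

noncomputable section

namespace Edwards

open MvPolynomial IsLocalRing

variable {K : Type*} [Field K]

section AffineCurve

/-! ### The affine curve is a Dedekind scheme -/

/-- The coordinate function `x` on the affine curve. -/
def xf (d : K) : Chart d 0 := Ideal.Quotient.mk _ (X 0)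

/-- The coordinate function `y` on the affine curve. -/
def yf (d : K) : Chart d 0 := Ideal.Quotient.mk _ (X 1)

/-- A polynomial in one variable, read as a function of `x` on the affine curve. -/
def evx (d : K) : Polynomial K →ₐ[K] Chart d 0 := Polynomial.aeval (xf d)

/-- The polynomial `1 - d x²`, the leading coefficient of the equation of the curve in `y`. -/
def den (d : K) : Polynomial K := 1 - Polynomial.C d * Polynomial.X ^ 2

/-- The polynomial `1 - x²`. -/
def num (K : Type*) [Field K] : Polynomial K := 1 - Polynomial.X ^ 2

/-- `1 - d x²` times the norm of `A(x) + B(x) y` over the field of rational functions in `x`. -/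
def normPoly (d : K) (A B : Polynomial K) : Polynomial K := A ^ 2 * den d - B ^ 2 * num K

theorem dehom_zero_form (d : K) :
    dehom 0 (form d) = X 0 ^ 2 + X 1 ^ 2 - 1 - C d * X 0 ^ 2 * X 1 ^ 2 := by
  have h1 : (Fin.insertNth (0 : Fin 3) (1 : MvPolynomial (Fin 2) K) X : Fin 3 → _) 1 = X 0 := rfl
  have h2 : (Fin.insertNth (0 : Fin 3) (1 : MvPolynomial (Fin 2) K) X : Fin 3 → _) 2 = X 1 := rfl
  simp only [form, dehom, map_sub, map_add, map_mul, map_pow, aeval_X, algHom_C, h1, h2,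
    Fin.insertNth_apply_same, algebraMap_eq]
  ring

theorem affine_equation (d : K) :
    xf d ^ 2 + yf d ^ 2 = 1 + algebraMap K _ d * xf d ^ 2 * yf d ^ 2 := by
  have h : Ideal.Quotient.mk (Ideal.span {dehom 0 (form d)}) (dehom 0 (form d)) = 0 :=
    Ideal.Quotient.eq_zero_iff_mem.2 (Ideal.mem_span_singleton_self _)
  have h' := congrArg (Ideal.Quotient.mk (Ideal.span {dehom 0 (form d)})) (dehom_zero_form d)
  rw [h] at h'
  simp only [map_sub, map_add, map_mul, map_pow, map_one] at h'
  change 0 = xf d ^ 2 + yf d ^ 2 - 1 - algebraMap K (Chart d 0) d * xf d ^ 2 * yf d ^ 2 at h'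
  linear_combination -h'

theorem evx_den (d : K) : evx d (den d) = 1 - algebraMap K _ d * xf d ^ 2 := by
  simp [evx, den]

theorem evx_num (d : K) : evx d (num K) = 1 - xf d ^ 2 := by
  simp [evx, num]

theorem evx_den_mul_sq (d : K) : evx d (den d) * yf d ^ 2 = evx d (num K) := by
  rw [evx_den, evx_num]
  linear_combination affine_equation d

/-- On the curve `(1 - d x²)(d y² - 1) = d - 1`, so `1 - d x²` has no zeros there. -/
theorem isUnit_evx_den {d : K} (hd : d - 1 ≠ 0) : IsUnit (evx d (den d)) := by
  have h : evx d (den d) * (algebraMap K _ d * yf d ^ 2 - 1) = algebraMap K _ (d - 1) := by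
    have := evx_den_mul_sq d
    rw [evx_num] at this
    rw [mul_sub, mul_left_comm, this, evx_den, map_sub, map_one]
    ring
  exact isUnit_of_mul_isUnit_left (h ▸ (IsUnit.mk0 _ hd).map (algebraMap K (Chart d 0)))

/-- Up to a power of the unit `1 - d x²`, every function on the affine curve is `A(x) + B(x) y`. -/
theorem exists_rep (d : K) (g : Chart d 0) :
    ∃ (n : ℕ) (A B : Polynomial K), evx d (den d) ^ n * g = evx d A + evx d B * yf d := by
  obtain ⟨f, rfl⟩ := Ideal.Quotient.mk_surjective g
  induction f using MvPolynomial.induction_on with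
  | C a => exact ⟨0, Polynomial.C a, 0, by simp [evx]; rfl⟩
  | add p q hp hq =>
    obtain ⟨n, A, B, h⟩ := hp
    obtain ⟨n', A', B', h'⟩ := hq
    refine ⟨n + n', den d ^ n' * A + den d ^ n * A', den d ^ n' * B + den d ^ n * B', ?_⟩
    simp only [map_add, map_mul, map_pow]
    linear_combination (evx d (den d) ^ n') * h + (evx d (den d) ^ n) * h'
  | mul_X p i hp =>
    obtain ⟨n, A, B, h⟩ := hp
    rw [map_mul]
    fin_cases i
    · refine ⟨n, A * Polynomial.X, B * Polynomial.X, ?_⟩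
      have hx : evx d Polynomial.X = xf d := by simp [evx]
      simp only [map_mul, hx]
      change _ * (_ * xf d) = _
      linear_combination xf d * h
    · refine ⟨n + 1, B * num K, A * den d, ?_⟩
      simp only [map_mul]
      change _ * (_ * yf d) = _
      linear_combination yf d * evx d (den d) * h + evx d B * evx_den_mul_sq d

/-- The functions `1` and `y` are independent over the polynomials in `x`: the equation of the
curve is quadratic in `y`. -/
theorem eq_zero_of_rep {d : K} {A B : Polynomial K} (h : evx d A + evx d B * yf d = 0) :
    A = 0 ∧ B = 0 := by
  let ψ : MvPolynomial (Fin 2) K →ₐ[K] Polynomial (Polynomial K) :=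
    aeval ![Polynomial.C Polynomial.X, Polynomial.X]
  let ev : Polynomial K →ₐ[K] MvPolynomial (Fin 2) K := Polynomial.aeval (X 0)
  have hev : ∀ P, evx d P = Ideal.Quotient.mk _ (ev P) := by
    intro P
    have : evx d = (Ideal.Quotient.mkₐ K _).comp ev := by
      ext; simp [evx, ev, xf]
    rw [this]; rfl
  have hψ : ∀ P, ψ (ev P) = Polynomial.C P := by
    intro P
    have : ψ.comp ev = (Algebra.ofId (Polynomial K) (Polynomial (Polynomial K))).restrictScalars K := by
      ext; simp [ψ, ev, Algebra.ofId_apply]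
    exact DFunLike.congr_fun this P
  rw [hev, hev, yf, ← map_mul, ← map_add, Ideal.Quotient.eq_zero_iff_mem,
    Ideal.mem_span_singleton] at h
  obtain ⟨q, hq⟩ := h
  have h2 := congrArg ψ hq
  have hφ : ψ (dehom 0 (form d)) =
      Polynomial.C (den d) * Polynomial.X ^ 2 - Polynomial.C (num K) := by
    rw [dehom_zero_form]
    simp [ψ, den, num]
    ring
  have hY : ψ (X 1) = Polynomial.X := by simp [ψ]
  rw [map_mul, hφ, map_add, map_mul, hψ, hψ, hY] at h2
  have hden : den d ≠ 0 := by
    intro h0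
    have := congrArg (Polynomial.eval 0) h0
    simp [den] at this
  have hdeg : (Polynomial.C (den d) * Polynomial.X ^ 2 - Polynomial.C (num K)).natDegree = 2 := by
    compute_degree!
  have hne : (Polynomial.C (den d) * Polynomial.X ^ 2 - Polynomial.C (num K)) ≠ 0 := by
    intro h0; rw [h0] at hdeg; simp at hdeg
  by_cases hq0 : ψ q = 0
  · rw [hq0, mul_zero] at h2
    have h0 := congrArg (Polynomial.coeff · 0) h2
    have h1 := congrArg (Polynomial.coeff · 1) h2
    simp at h0 h1
    exact ⟨h0, h1⟩
  · exfalso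
    have h3 := congrArg Polynomial.natDegree h2
    rw [Polynomial.natDegree_mul hne hq0, hdeg] at h3
    have : (Polynomial.C A + Polynomial.C B * Polynomial.X).natDegree ≤ 1 := by compute_degree
    omega

theorem evx_injective (d : K) : Function.Injective (evx d) := by
  rw [injective_iff_map_eq_zero]
  intro P hP
  exact (eq_zero_of_rep (B := 0) (by simpa using hP)).1

/-- The product of a function with its conjugate under `y ↦ -y` is a polynomial in `x`, up to the
unit `1 - d x²`. -/
theorem conj_mul (d : K) (A B : Polynomial K) :
    (evx d A + evx d B * yf d) * (evx d A - evx d B * yf d) * evx d (den d)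
      = evx d (normPoly d A B) := by
  simp only [normPoly, map_sub, map_mul, map_pow]
  linear_combination - evx d B ^ 2 * evx_den_mul_sq d

/-- The norm does not vanish: `(1 - x²)(1 - d x²)` is not a square, since it has a simple zero
at `x = 1`. -/
theorem normPoly_ne_zero [NeZero (2 : K)] {d : K} (hd : d - 1 ≠ 0) {A B : Polynomial K}
    (h : A ≠ 0 ∨ B ≠ 0) : normPoly d A B ≠ 0 := by
  intro h0
  have hden1 : (den d).eval 1 ≠ 0 := by
    simp only [den]; simp; intro h; apply hd; linear_combination -h
  have hden : den d ≠ 0 := by rintro h; simp [h] at hden1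
  have hnum : num K = (Polynomial.X - Polynomial.C 1) * (- (Polynomial.X + 1)) := by
    simp [num]; ring
  have he : (-(Polynomial.X + 1) : Polynomial K).eval 1 ≠ 0 := by
    simp
    intro h
    apply NeZero.ne (2 : K)
    linear_combination -h
  have hnum0 : num K ≠ 0 := by
    rw [hnum]
    refine mul_ne_zero (Polynomial.X_sub_C_ne_zero 1) ?_
    rintro h; rw [h] at he; simp at he
  have hnumr : (num K).rootMultiplicity 1 = 1 := by
    rw [hnum, Polynomial.rootMultiplicity_mul (hnum ▸ hnum0),
      Polynomial.rootMultiplicity_X_sub_C_self, Polynomial.rootMultiplicity_eq_zero he]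
  have heq : A ^ 2 * den d = B ^ 2 * num K := by
    rw [normPoly] at h0; exact sub_eq_zero.1 h0
  have hA : A ≠ 0 := by
    rintro rfl
    simp [hnum0] at heq
    simp [heq] at h
  have hB : B ≠ 0 := by
    rintro rfl
    simp [hden] at heq
    exact hA heq
  have hr := congrArg (Polynomial.rootMultiplicity 1) heq
  rw [Polynomial.rootMultiplicity_mul (mul_ne_zero (pow_ne_zero _ hA) hden),
    Polynomial.rootMultiplicity_mul (mul_ne_zero (pow_ne_zero _ hB) hnum0), hnumr,
    Polynomial.rootMultiplicity_eq_zero hden1, sq, sq,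
    Polynomial.rootMultiplicity_mul (mul_ne_zero hA hA),
    Polynomial.rootMultiplicity_mul (mul_ne_zero hB hB)] at hr
  omega

theorem d_ne_zero {d : K} [hd : Fact (d * (d - 1) ≠ 0)] : d ≠ 0 := left_ne_zero_of_mul hd.out

theorem d_sub_one_ne_zero {d : K} [hd : Fact (d * (d - 1) ≠ 0)] : d - 1 ≠ 0 :=
  right_ne_zero_of_mul hd.out

theorem isUnit_den {d : K} [Fact (d * (d - 1) ≠ 0)] : IsUnit (evx d (den d)) :=
  isUnit_evx_den d_sub_one_ne_zero

/-- Where `1 - d x²` is invertible, the curve is a double cover of the `x`-line. -/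
theorem finrank_quotient_evx {d : K} {p : Polynomial K} (hp0 : p ≠ 0) (hp : IsCoprime p (den d)) :
    Module.Finite K (Chart d 0 ⧸ Ideal.span {evx d p}) ∧
      Module.finrank K (Chart d 0 ⧸ Ideal.span {evx d p}) = 2 * p.natDegree := by
  let q : Chart d 0 →ₐ[K] Chart d 0 ⧸ Ideal.span {evx d p} := Ideal.Quotient.mkₐ K _
  have hq : Function.Surjective q := Ideal.Quotient.mkₐ_surjective _ _
  have hqp : ∀ r, q r = 0 ↔ evx d p ∣ r := fun r => by
    rw [← Ideal.mem_span_singleton]; exact Ideal.Quotient.eq_zero_iff_mem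
  have hdvd : ∀ A B : Polynomial K, evx d p ∣ evx d A + evx d B * yf d → p ∣ A ∧ p ∣ B := by
    rintro A B ⟨g, hg⟩
    obtain ⟨n, A', B', hr⟩ := exists_rep d g
    have h0 : evx d (den d ^ n * A - p * A') + evx d (den d ^ n * B - p * B') * yf d = 0 := by
      simp only [map_sub, map_mul, map_pow]
      linear_combination evx d (den d) ^ n * hg + evx d p * hr
    obtain ⟨h1, h2⟩ := eq_zero_of_rep h0
    exact ⟨(hp.pow_right (n := n)).dvd_of_dvd_mul_left ⟨_, sub_eq_zero.1 h1⟩,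
      (hp.pow_right (n := n)).dvd_of_dvd_mul_left ⟨_, sub_eq_zero.1 h2⟩⟩
  let Φ : (Polynomial K ⧸ Ideal.span {p}) →ₐ[K] Chart d 0 ⧸ Ideal.span {evx d p} :=
    Ideal.Quotient.liftₐ _ (q.comp (evx d)) (fun a ha => by
      rw [Ideal.mem_span_singleton] at ha
      exact (hqp _).2 (map_dvd _ ha))
  have hΦ : ∀ A, Φ (Ideal.Quotient.mk _ A) = q (evx d A) := fun A => rfl
  let Ψ : (Polynomial K ⧸ Ideal.span {p}) × (Polynomial K ⧸ Ideal.span {p}) →ₗ[K]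
      Chart d 0 ⧸ Ideal.span {evx d p} :=
    LinearMap.coprod Φ.toLinearMap ((LinearMap.mulRight K (q (yf d))).comp Φ.toLinearMap)
  have hΨ : ∀ A B, Ψ (Ideal.Quotient.mk _ A, Ideal.Quotient.mk _ B)
      = q (evx d A + evx d B * yf d) := fun A B => by
    simp [Ψ, hΦ]
  have hinj : Function.Injective Ψ := by
    rw [injective_iff_map_eq_zero]
    rintro ⟨a, b⟩ hab
    obtain ⟨A, rfl⟩ := Ideal.Quotient.mk_surjective a
    obtain ⟨B, rfl⟩ := Ideal.Quotient.mk_surjective b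
    rw [hΨ, hqp] at hab
    obtain ⟨h1, h2⟩ := hdvd A B hab
    rw [Prod.mk_eq_zero, Ideal.Quotient.eq_zero_iff_mem, Ideal.Quotient.eq_zero_iff_mem,
      Ideal.mem_span_singleton, Ideal.mem_span_singleton]
    exact ⟨h1, h2⟩
  have hsurj : Function.Surjective Ψ := by
    intro r
    obtain ⟨g, rfl⟩ := hq r
    obtain ⟨n, A, B, hr⟩ := exists_rep d g
    obtain ⟨u, v, huv⟩ := (hp.pow_right (n := n))
    refine ⟨(Ideal.Quotient.mk _ (v * A), Ideal.Quotient.mk _ (v * B)), ?_⟩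
    rw [hΨ, ← sub_eq_zero, ← map_sub, hqp]
    have huv' := congrArg (evx d) huv
    simp only [map_add, map_mul, map_pow, map_one] at huv' ⊢
    exact ⟨- evx d u * g, by linear_combination - evx d v * hr + g * huv'⟩
  have e := LinearEquiv.ofBijective Ψ ⟨hinj, hsurj⟩
  have hfin : Module.Finite K (Polynomial K ⧸ Ideal.span {p}) :=
    (AdjoinRoot.powerBasis hp0).finite
  have hrank : Module.finrank K (Polynomial K ⧸ Ideal.span {p}) = p.natDegree :=
    finrank_quotient_span_eq_natDegree
  refine ⟨Module.Finite.equiv e, ?_⟩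
  rw [← e.finrank_eq, Module.finrank_prod, hrank, two_mul]

variable {d : K} [Fact (d * (d - 1) ≠ 0)]

theorem isCoprime_den_of_irreducible_mem {P : Ideal (Chart d 0)} (hP : P.IsPrime)
    {p : Polynomial K} (hp : Irreducible p) (hmem : evx d p ∈ P) : IsCoprime p (den d) := by
  rw [hp.coprime_iff_not_dvd]
  intro h
  exact hP.ne_top (Ideal.eq_top_of_isUnit_mem _ (P.mem_of_dvd (map_dvd (evx d) h) hmem) isUnit_den)

section Smooth

variable [NeZero (2 : K)]

/-- A nonzero function has a nonzero multiple that is a polynomial in `x`. -/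
theorem exists_mul_eq_evx {g : Chart d 0} (hg : g ≠ 0) :
    ∃ (h : Chart d 0) (P : Polynomial K), P ≠ 0 ∧ h * g = evx d P := by
  obtain ⟨n, A, B, hr⟩ := exists_rep d g
  refine ⟨evx d (den d) ^ (n + 1) * (evx d A - evx d B * yf d), normPoly d A B, ?_, ?_⟩
  · apply normPoly_ne_zero (d_sub_one_ne_zero (d := d))
    by_contra! h0
    rw [h0.1, h0.2, map_zero, zero_mul, add_zero, (isUnit_den.pow n).mul_right_eq_zero] at hr
    exact hg hr
  · rw [← conj_mul, ← hr]
    ring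

/-- A domain, because the norm of a nonzero function is a nonzero polynomial in `x`. -/
instance : IsDomain (Chart d 0) := by
  have hnt : Nontrivial (Chart d 0) := (evx_injective d).nontrivial
  have : NoZeroDivisors (Chart d 0) := by
    refine ⟨fun {f g} hfg => ?_⟩
    by_contra! h0
    obtain ⟨f', P, hP, hf⟩ := exists_mul_eq_evx h0.1
    obtain ⟨g', Q, hQ, hg⟩ := exists_mul_eq_evx h0.2
    have : evx d (P * Q) = 0 := by
      rw [map_mul, ← hf, ← hg]
      linear_combination f' * g' * hfg
    exact mul_ne_zero hP hQ ((map_eq_zero_iff _ (evx_injective d)).1 this)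
  exact NoZeroDivisors.to_isDomain _

/-- A nonzero prime contracts to a nonzero prime of `K[x]`. -/
theorem exists_irreducible_mem {P : Ideal (Chart d 0)} (hP : P.IsPrime) (h0 : P ≠ ⊥) :
    ∃ p : Polynomial K, Irreducible p ∧ ∀ q, evx d q ∈ P ↔ p ∣ q := by
  obtain ⟨g, hg, hg0⟩ := Submodule.exists_mem_ne_zero_of_ne_bot h0
  obtain ⟨h, Q, hQ, hhg⟩ := exists_mul_eq_evx hg0
  have hprime : (P.comap (evx d).toRingHom).IsPrime := Ideal.comap_isPrime _ _
  obtain ⟨p, hp⟩ := IsPrincipalIdealRing.principal (P.comap (evx d).toRingHom)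
  have hp' : P.comap (evx d).toRingHom = Ideal.span {p} := hp
  have hmem : ∀ q, evx d q ∈ P ↔ p ∣ q := by
    intro q
    rw [← Ideal.mem_span_singleton, ← hp']
    rfl
  have hp0 : p ≠ 0 := by
    rintro rfl
    refine hQ (zero_dvd_iff.1 ((hmem Q).1 ?_))
    rw [← hhg]
    exact P.mul_mem_left _ hg
  rw [hp', Ideal.span_singleton_prime hp0] at hprime
  exact ⟨p, hprime.irreducible, hmem⟩

/-- A nonzero prime of the affine curve is generated locally by one element: by the irreducible
polynomial in `x` that it contains if it does not contain `y` (the curve is then unramified over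
the `x`-line), and by `y` otherwise. -/
theorem exists_local_generator {P : Ideal (Chart d 0)} (hP : P.IsPrime) (h0 : P ≠ ⊥) :
    ∃ t ∈ P, ∀ g ∈ P, ∃ s ∉ P, t ∣ s * g := by
  obtain ⟨p, hp, hmem⟩ := exists_irreducible_mem hP h0
  have hden : ∀ n, evx d (den d) ^ n ∉ P := fun n h =>
    hP.ne_top (Ideal.eq_top_of_isUnit_mem _ h (isUnit_den.pow n))
  have h2 : (2 : Chart d 0) ∉ P := by
    intro h
    have : IsUnit (2 : Chart d 0) := by
      have := (IsUnit.mk0 (2 : K) (NeZero.ne 2)).map (algebraMap K (Chart d 0))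
      rwa [map_ofNat] at this
    exact hP.ne_top (Ideal.eq_top_of_isUnit_mem _ h this)
  by_cases hy : yf d ∈ P
  · refine ⟨yf d, hy, fun g hg => ?_⟩
    have hx : evx d (num K) ∈ P := by
      rw [← evx_den_mul_sq]
      exact P.mul_mem_left _ (P.pow_mem_of_mem hy 2 two_pos)
    obtain ⟨e, he, hxe⟩ : ∃ e : K, e ^ 2 = 1 ∧ xf d - algebraMap K _ e ∈ P := by
      have : (xf d - algebraMap K _ 1) * (xf d - algebraMap K _ (-1)) ∈ P := by
        have h : (xf d - algebraMap K _ 1) * (xf d - algebraMap K _ (-1)) = - evx d (num K) := by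
          rw [evx_num]; simp; ring
        rw [h]; exact P.neg_mem hx
      rcases hP.mem_or_mem this with h | h
      · exact ⟨1, by norm_num, h⟩
      · exact ⟨-1, by norm_num, h⟩
    -- At the points `(±1, 0)` the other root of `1 - x²` is a unit, and `y² (1 - d x²) = 1 - x²`
    -- expresses `x - e` through `y`.
    have he0 : e ≠ 0 := by rintro rfl; norm_num at he
    have hs : xf d + algebraMap K _ e ∉ P := by
      intro h
      have h3 : 2 * algebraMap K (Chart d 0) e ∈ P := by
        have := P.sub_mem h hxe
        ring_nf at this
        rwa [mul_comm] at this
      rcases hP.mem_or_mem h3 with h | h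
      · exact h2 h
      · exact hP.ne_top (Ideal.eq_top_of_isUnit_mem _ h ((IsUnit.mk0 e he0).map _))
    obtain ⟨n, A, B, hr⟩ := exists_rep d g
    have hA : evx d A ∈ P := by
      have : evx d A = evx d (den d) ^ n * g - evx d B * yf d := by rw [hr]; ring
      rw [this]
      exact P.sub_mem (P.mul_mem_left _ hg) (P.mul_mem_left _ hy)
    have hpe : p ∣ Polynomial.X - Polynomial.C e := by
      rw [← hmem]
      simpa [evx] using hxe
    have hA' : Polynomial.X - Polynomial.C e ∣ A :=
      ((hp.associated_of_dvd (Polynomial.irreducible_X_sub_C e) hpe).symm.dvd).trans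
        ((hmem A).1 hA)
    obtain ⟨A', rfl⟩ := hA'
    refine ⟨(xf d + algebraMap K _ e) * evx d (den d) ^ n, hP.mul_notMem hs (hden n),
      - yf d * evx d (den d) * evx d A' + (xf d + algebraMap K _ e) * evx d B, ?_⟩
    have he' : algebraMap K (Chart d 0) e ^ 2 = 1 := by rw [← map_pow, he, map_one]
    have h4 := evx_den_mul_sq d
    rw [evx_num] at h4
    have h5 : evx d ((Polynomial.X - Polynomial.C e) * A')
        = (xf d - algebraMap K _ e) * evx d A' := by simp [evx]
    rw [h5] at hr
    linear_combination (xf d + algebraMap K _ e) * hr - evx d A' * he' + evx d A' * h4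
  · refine ⟨evx d p, (hmem p).2 dvd_rfl, fun g hg => ?_⟩
    obtain ⟨n, A, B, hr⟩ := exists_rep d g
    by_cases hB : p ∣ B
    · have hA : evx d A ∈ P := by
        have : evx d A = evx d (den d) ^ n * g - evx d B * yf d := by rw [hr]; ring
        rw [this]
        exact P.sub_mem (P.mul_mem_left _ hg) (P.mul_mem_right _ ((hmem B).2 hB))
      refine ⟨evx d (den d) ^ n, hden n, ?_⟩
      rw [hr]
      exact dvd_add (map_dvd _ ((hmem A).1 hA)) (Dvd.dvd.mul_right (map_dvd _ hB) _)
    · obtain ⟨u, v, huv⟩ := (hp.coprime_iff_not_dvd.2 hB)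
      -- `v` inverts `B` modulo `p`, so `g` is, up to a unit, congruent to `y + c` modulo `p`.
      have huv' : evx d u * evx d p + evx d v * evx d B = 1 := by
        rw [← map_mul, ← map_mul, ← map_add, huv, map_one]
      obtain ⟨c, hc⟩ : ∃ c, c = v * A := ⟨_, rfl⟩
      have hc' : evx d c = evx d v * evx d A := by rw [hc, map_mul]
      have hyc : yf d + evx d c ∈ P := by
        have : yf d + evx d c = evx d v * (evx d (den d) ^ n * g) + evx d p * (evx d u * yf d) := by
          rw [hr, hc']; linear_combination - yf d * huv'
        rw [this]
        exact P.add_mem (P.mul_mem_left _ (P.mul_mem_left _ hg))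
          (P.mul_mem_right _ ((hmem p).2 dvd_rfl))
      have hyc' : yf d - evx d c ∉ P := by
        intro h
        have : 2 * yf d ∈ P := by
          have := P.add_mem h hyc
          ring_nf at this
          rwa [mul_comm] at this
        exact (hP.mem_or_mem this).elim h2 hy
      have hN : p ∣ num K - c ^ 2 * den d := by
        rw [← hmem]
        have : evx d (num K - c ^ 2 * den d)
            = evx d (den d) * (yf d - evx d c) * (yf d + evx d c) := by
          simp only [map_sub, map_mul, map_pow]
          linear_combination - evx_den_mul_sq d
        rw [this]
        exact P.mul_mem_left _ hyc
      refine ⟨(yf d - evx d c) * evx d (den d) ^ (n + 1), hP.mul_notMem hyc' (hden _), ?_⟩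
      obtain ⟨r, hr'⟩ := hN
      have hr'' := congrArg (evx d) hr'
      simp only [map_sub, map_mul, map_pow] at hr''
      refine ⟨evx d B * evx d r + (yf d - evx d c) * evx d (den d) * evx d u * evx d A, ?_⟩
      linear_combination (yf d - evx d c) * evx d (den d) * hr
        + evx d B * evx_den_mul_sq d + evx d B * hr''
        - (yf d - evx d c) * evx d (den d) * evx d A * huv'
        - (yf d - evx d c) * evx d (den d) * evx d B * hc'

/-- The affine Edwards curve is regular. -/
instance : IsDedekindDomainDvr (Chart d 0) where
  is_dvr_at_nonzero_prime P h0 hP := by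
    have hnf := IsLocalization.AtPrime.not_isField (Chart d 0) h0 (Localization.AtPrime P)
    refine ((IsDiscreteValuationRing.TFAE (Localization.AtPrime P) hnf).out 0 4).2 ?_
    obtain ⟨t, ht, hgen⟩ := exists_local_generator hP h0
    refine ⟨algebraMap _ _ t, ?_⟩
    rw [← Localization.AtPrime.map_eq_maximalIdeal]
    apply le_antisymm
    · refine Ideal.map_le_iff_le_comap.2 fun g hg => ?_
      obtain ⟨s, hs, hd⟩ := hgen g hg
      have hs' : IsUnit (algebraMap _ (Localization.AtPrime P) s) :=
        IsLocalization.map_units (M := P.primeCompl) _ ⟨s, hs⟩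
      have := map_dvd (algebraMap _ (Localization.AtPrime P)) hd
      rw [map_mul, hs'.dvd_mul_left] at this
      exact Ideal.mem_span_singleton.2 this
    · rw [Submodule.span_le, Set.singleton_subset_iff]
      exact Ideal.mem_map_of_mem _ ht

end Smooth

end AffineCurve

section AffineDivisors

/-! ### Ideals and divisors on the affine curve -/

section DedekindDomain

variable {A : Type*} [CommRing A] [IsDedekindDomain A]

/-- The order of an element at a prime of a Dedekind domain is the exponent of that prime in the
factorization of the ideal generated by the element. -/
theorem ord_atPrime {m : Ideal A} [hm : m.IsPrime] (h0 : m ≠ ⊥) {f : A} (hf : f ≠ 0) :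
    Ring.ord (Localization.AtPrime m) (algebraMap _ _ f) = multiplicity m (Ideal.span {f}) := by
  have hf' : Ideal.span {f} ≠ 0 := by simpa using hf
  have hdvr : IsDiscreteValuationRing (Localization.AtPrime m) :=
    IsLocalization.AtPrime.isDiscreteValuationRing_of_dedekind_domain A h0 _
  obtain ⟨J, hJ, hJm⟩ :=
    (FiniteMultiplicity.of_prime_left (Ideal.prime_of_isPrime h0 hm) hf').exists_eq_pow_mul_and_not_dvd
  obtain ⟨ϖ, hϖ⟩ := IsDiscreteValuationRing.exists_irreducible (Localization.AtPrime m)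
  have hJtop : J.map (algebraMap A (Localization.AtPrime m)) = ⊤ := by
    rw [Ideal.dvd_iff_le] at hJm
    obtain ⟨s, hs, hsm⟩ := Set.not_subset.1 hJm
    exact Ideal.eq_top_of_isUnit_mem _ (Ideal.mem_map_of_mem _ hs)
      (IsLocalization.map_units (M := m.primeCompl) _ ⟨s, hsm⟩)
  have hspan : Ideal.span {algebraMap A (Localization.AtPrime m) f}
      = Ideal.span {ϖ ^ multiplicity m (Ideal.span {f})} := by
    rw [← Set.image_singleton, ← Ideal.map_span]
    conv_lhs => rw [hJ]
    rw [Ideal.map_mul, Ideal.map_pow, hJtop, Ideal.mul_top, Localization.AtPrime.map_eq_maximalIdeal,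
      hϖ.maximalIdeal_eq, Ideal.span_singleton_pow]
  have hpow := Ring.ord_pow (mem_nonZeroDivisors_of_ne_zero hϖ.ne_zero)
    (multiplicity m (Ideal.span {f}))
  rw [Ring.ord_of_irreducible hϖ] at hpow
  rw [Ring.ord, hspan]
  exact hpow.trans (by simp)

/-- Dimensions of quotients by ideals of a Dedekind domain are additive: `I / m I` is a line over
`A / m`. -/
theorem finrank_quotient_mul [Algebra K A] {m : Ideal A} (hm : m.IsMaximal)
    [Module.Finite K (A ⧸ m)] {I : Ideal A} (hI : I ≠ 0) [Module.Finite K (A ⧸ I)] :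
    Module.Finite K (A ⧸ m * I) ∧
      Module.finrank K (A ⧸ m * I) = Module.finrank K (A ⧸ m) + Module.finrank K (A ⧸ I) := by
  have hlt : m * I < I := by
    refine lt_of_le_of_ne Ideal.mul_le_right fun h => ?_
    have h' : m * I = 1 * I := by rw [h, one_mul]
    exact hm.ne_top ((mul_right_cancel₀ hI h').trans Ideal.one_eq_top)
  obtain ⟨a, haI, ha⟩ := SetLike.exists_of_lt hlt
  have hsup : Ideal.span {a} ⊔ m * I = I := by
    have hle : Ideal.span {a} ⊔ m * I ≤ I :=
      sup_le ((Ideal.span_singleton_le_iff_mem _).2 haI) hlt.le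
    obtain ⟨J, hJ⟩ := Ideal.dvd_iff_le.2 hle
    have hmJ : m ≤ J := by
      have h : m * I ≤ J * I := by
        rw [mul_comm J, ← hJ]; exact le_sup_right
      rw [← Ideal.dvd_iff_le] at h ⊢
      exact (mul_dvd_mul_iff_right hI).1 h
    rcases hmJ.eq_or_lt with h | h
    · exfalso
      apply ha
      rw [h, mul_comm, ← hJ]
      exact Ideal.mem_sup_left (Ideal.mem_span_singleton_self a)
    · rw [hm.out.2 _ h] at hJ
      simpa using hJ
  let φ : A →ₗ[A] A ⧸ m * I := (Submodule.mkQ (m * I)).comp (LinearMap.mulRight _ a)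
  have hφ : LinearMap.ker φ = m := by
    have hle : m ≤ LinearMap.ker φ := fun r hr => by
      simp only [φ, LinearMap.mem_ker, LinearMap.comp_apply, LinearMap.mulRight_apply,
        Submodule.mkQ_apply, Submodule.Quotient.mk_eq_zero]
      exact Ideal.mul_mem_mul hr haI
    refine (hm.eq_of_le (fun h => ha ?_) hle).symm
    have : (1 : A) ∈ LinearMap.ker φ := by rw [h]; trivial
    simpa [φ, LinearMap.mem_ker, Ideal.Quotient.eq_zero_iff_mem] using this
  let ι : (A ⧸ m) →ₗ[A] A ⧸ m * I := Submodule.liftQ m φ hφ.ge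
  let ρ : (A ⧸ m * I) →ₗ[A] A ⧸ I := Submodule.factor hlt.le
  have hι : Function.Injective ι := by
    rw [← LinearMap.ker_eq_bot]
    exact Submodule.ker_liftQ_eq_bot' _ _ hφ.symm
  have hρ : Function.Surjective ρ := Submodule.factor_surjective hlt.le
  have hexact : ∀ y, ρ y = 0 ↔ y ∈ Set.range ι := by
    intro y
    obtain ⟨b, rfl⟩ := Submodule.Quotient.mk_surjective _ y
    have h1 : ρ (Submodule.Quotient.mk b) = 0 ↔ b ∈ I := Submodule.Quotient.mk_eq_zero I
    rw [h1]
    constructor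
    · intro hb
      rw [← hsup] at hb
      obtain ⟨u, hu, v, hv, rfl⟩ := Submodule.mem_sup.1 hb
      obtain ⟨r, rfl⟩ := Ideal.mem_span_singleton'.1 hu
      refine ⟨Submodule.Quotient.mk r, ?_⟩
      refine (Submodule.Quotient.eq _).2 ?_
      rw [LinearMap.mulRight_apply, sub_add_cancel_left]
      exact neg_mem hv
    · rintro ⟨r, hr⟩
      obtain ⟨r, rfl⟩ := Submodule.Quotient.mk_surjective _ r
      have h2 : r * a - b ∈ m * I := (Submodule.Quotient.eq _).1 hr
      have h3 := I.sub_mem (I.mul_mem_left r haI) (hlt.le h2)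
      rwa [sub_sub_cancel] at h3
  have hexK : Function.Exact (ι.restrictScalars K) (ρ.restrictScalars K) := hexact
  have hfin : Module.Finite K (A ⧸ m * I) := Module.Finite.of_exact hexK hρ
  refine ⟨hfin, ?_⟩
  have h1 := LinearMap.finrank_range_add_finrank_ker (ρ.restrictScalars K)
  have hrange : LinearMap.range (ρ.restrictScalars K) = ⊤ := LinearMap.range_eq_top.2 hρ
  rw [hrange, finrank_top,
    LinearMap.exact_iff.1 hexK, LinearMap.finrank_range_of_inj (f := ι.restrictScalars K) hι] at h1
  omega

end DedekindDomain

theorem degree_single {d : K} (P : ClosedPoint d) (n : ℤ) :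
    Divisor.degree d (Finsupp.single P n) = n * P.degree := by
  simp [Divisor.degree]

/-- The coordinate ring is not a field: `x` is not invertible, as it vanishes at the two points
`(0, ±1)`. -/
theorem maximalSpectrum_ne_bot {d : K} (m : MaximalSpectrum (Chart d 0)) : m.asIdeal ≠ ⊥ := by
  intro h
  have hx : xf d ∉ m.asIdeal := by
    rw [h, Ideal.mem_bot]
    intro h0
    have := evx_injective d (a₁ := Polynomial.X) (a₂ := 0) (by simpa [evx] using h0)
    exact Polynomial.X_ne_zero this
  obtain ⟨g, hg⟩ := m.isMaximal.exists_inv hx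
  rw [h] at hg
  obtain ⟨i, hi, hi'⟩ := hg
  rw [Ideal.mem_bot] at hi
  have hx1 : Ideal.span {evx d Polynomial.X} = ⊤ := by
    rw [Ideal.eq_top_iff_one, Ideal.mem_span_singleton]
    exact ⟨g, by rw [← hi', hi]; simp [evx, mul_comm]⟩
  have hcop : IsCoprime (Polynomial.X : Polynomial K) (den d) :=
    ⟨Polynomial.C d * Polynomial.X, 1, by simp only [den]; ring⟩
  have hr := (finrank_quotient_evx Polynomial.X_ne_zero hcop).2
  have : Subsingleton (Chart d 0 ⧸ Ideal.span {evx d Polynomial.X}) :=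
    Ideal.Quotient.subsingleton_iff.2 hx1
  rw [Module.finrank_zero_of_subsingleton, Polynomial.natDegree_X] at hr
  omega

variable [NeZero (2 : K)] {d : K} [Fact (d * (d - 1) ≠ 0)]

theorem prime_asIdeal (m : MaximalSpectrum (Chart d 0)) : Prime m.asIdeal :=
  Ideal.prime_of_isPrime (maximalSpectrum_ne_bot m) m.isMaximal.isPrime

theorem finiteMultiplicity (m : MaximalSpectrum (Chart d 0)) {I : Ideal (Chart d 0)} (hI : I ≠ 0) :
    FiniteMultiplicity m.asIdeal I :=
  FiniteMultiplicity.of_prime_left (prime_asIdeal m) hI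

theorem finite_setOf_dvd {I : Ideal (Chart d 0)} (hI : I ≠ 0) :
    {m : MaximalSpectrum (Chart d 0) | m.asIdeal ∣ I}.Finite := by
  let f : MaximalSpectrum (Chart d 0) → IsDedekindDomain.HeightOneSpectrum (Chart d 0) :=
    fun m => ⟨m.asIdeal, m.isMaximal.isPrime, maximalSpectrum_ne_bot m⟩
  have hf : Function.Injective f := fun m n h =>
    MaximalSpectrum.ext (congrArg IsDedekindDomain.HeightOneSpectrum.asIdeal h)
  exact Set.Finite.preimage (f := f) hf.injOn (Ideal.finite_factors hI)

open Classical in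
/-- The divisor on the affine curve cut out by a nonzero ideal (and `0` for the zero ideal). -/
def idealDiv (I : Ideal (Chart d 0)) : Divisor d :=
  if hI : I = 0 then 0 else
    Finsupp.ofSupportFinite
      (fun P => match P with
        | .affine m => (multiplicity m.asIdeal I : ℤ)
        | .omega1 => 0
        | .omega2 => 0)
      (((finite_setOf_dvd hI).image ClosedPoint.affine).subset (by
        rintro (m | _ | _) h
        · refine ⟨m, ?_, rfl⟩
          by_contra h0
          exact h (by simpa using multiplicity_eq_zero.2 h0)
        · exact absurd rfl h
        · exact absurd rfl h))

theorem idealDiv_affine {I : Ideal (Chart d 0)} (hI : I ≠ 0) (m : MaximalSpectrum (Chart d 0)) :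
    idealDiv I (.affine m) = multiplicity m.asIdeal I := by
  rw [idealDiv, dif_neg hI]; rfl

theorem idealDiv_omega1 (I : Ideal (Chart d 0)) : idealDiv I .omega1 = 0 := by
  rw [idealDiv]; split_ifs <;> rfl

theorem idealDiv_omega2 (I : Ideal (Chart d 0)) : idealDiv I .omega2 = 0 := by
  rw [idealDiv]; split_ifs <;> rfl

theorem idealDiv_mul {I J : Ideal (Chart d 0)} (hI : I ≠ 0) (hJ : J ≠ 0) :
    idealDiv (I * J) = idealDiv I + idealDiv J := by
  ext (m | _ | _)
  · rw [Finsupp.add_apply, idealDiv_affine hI, idealDiv_affine hJ, idealDiv_affine (mul_ne_zero hI hJ),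
      multiplicity_mul (prime_asIdeal m) (finiteMultiplicity m (mul_ne_zero hI hJ)), Nat.cast_add]
  · simp [idealDiv_omega1]
  · simp [idealDiv_omega2]

theorem idealDiv_top : idealDiv (⊤ : Ideal (Chart d 0)) = 0 := by
  have h1 : (⊤ : Ideal (Chart d 0)) ≠ 0 := top_ne_bot
  simpa using idealDiv_mul h1 h1

open Classical in
theorem idealDiv_maximal (m : MaximalSpectrum (Chart d 0)) :
    idealDiv m.asIdeal = Finsupp.single (.affine m) 1 := by
  ext (n | _ | _)
  · rw [idealDiv_affine (prime_asIdeal m).ne_zero, Finsupp.single_apply]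
    split_ifs with h
    · obtain rfl : m = n := by simpa using h
      rw [multiplicity_self, Nat.cast_one]
    · rw [multiplicity_eq_zero.2, Nat.cast_zero]
      intro hdvd
      rw [(prime_asIdeal n).dvd_prime_iff_associated (prime_asIdeal m), associated_iff_eq] at hdvd
      exact h (by rw [MaximalSpectrum.ext hdvd])
  · rw [idealDiv_omega1]; simp
  · rw [idealDiv_omega2]; simp

theorem finite_quotient_maximal {m : Ideal (Chart d 0)} (hm : m.IsMaximal) :
    Module.Finite K (Chart d 0 ⧸ m) := by
  obtain ⟨p, hp, hmem⟩ := exists_irreducible_mem hm.isPrime (maximalSpectrum_ne_bot ⟨m, hm⟩)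
  have hpm : evx d p ∈ m := (hmem p).2 dvd_rfl
  have := (finrank_quotient_evx hp.ne_zero
    (isCoprime_den_of_irreducible_mem hm.isPrime hp hpm)).1
  have hle : Ideal.span {evx d p} ≤ m := (Ideal.span_singleton_le_iff_mem _).2 hpm
  exact Module.Finite.of_surjective (Ideal.Quotient.factorₐ K hle).toLinearMap
    (Ideal.Quotient.factor_surjective hle)

/-- The divisor of a nonzero ideal `I` has degree `dim (R / I)`. -/
theorem degree_idealDiv {I : Ideal (Chart d 0)} (hI : I ≠ 0) :
    Module.Finite K (Chart d 0 ⧸ I) ∧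
      Divisor.degree d (idealDiv I) = Module.finrank K (Chart d 0 ⧸ I) := by
  induction I using UniqueFactorizationMonoid.induction_on_prime with
  | h₁ => exact absurd rfl hI
  | h₂ I hu =>
    rw [Ideal.isUnit_iff] at hu
    subst hu
    have : Subsingleton (Chart d 0 ⧸ (⊤ : Ideal (Chart d 0))) :=
      Ideal.Quotient.subsingleton_iff.2 rfl
    refine ⟨inferInstance, ?_⟩
    rw [idealDiv_top, map_zero, Module.finrank_zero_of_subsingleton, Nat.cast_zero]
  | h₃ I p hI0 hp ih =>
    obtain ⟨hfin, hdeg⟩ := ih hI0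
    have hpm : p.IsMaximal := (Ideal.isPrime_of_prime hp).isMaximal hp.ne_zero
    have := finite_quotient_maximal hpm
    obtain ⟨h1, h2⟩ := finrank_quotient_mul (K := K) hpm hI0
    refine ⟨h1, ?_⟩
    rw [idealDiv_mul hp.ne_zero hI0, map_add, hdeg, h2, idealDiv_maximal ⟨p, hpm⟩, degree_single,
      one_mul, Nat.cast_add]
    rfl

theorem finrank_quotient_eq_add {I J : Ideal (Chart d 0)} (hI : I ≠ 0) (hJ : J ≠ 0) :
    Module.finrank K (Chart d 0 ⧸ I * J)
      = Module.finrank K (Chart d 0 ⧸ I) + Module.finrank K (Chart d 0 ⧸ J) := by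
  have h := (degree_idealDiv (mul_ne_zero hI hJ)).2
  rw [idealDiv_mul hI hJ, map_add, (degree_idealDiv hI).2, (degree_idealDiv hJ).2] at h
  exact_mod_cast h.symm

end AffineDivisors

section Nodes

/-! ### Local algebra of a node -/

/-- A local `K`-algebra `O` with residue field `K` is a node with branches `z² = d w²` (which are
conjugate over `K` when `d` is not a square) in the coordinates `z` and `w`: its maximal ideal is
generated by `z` and `w`, these are independent modulo its square, and they satisfy the equation of
the projective Edwards curve at a point at infinity. -/
structure IsNode {O : Type*} [CommRing O] [IsLocalRing O] [Algebra K O] (d : K) (z w : O) :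
    Prop where
  maximal : maximalIdeal O = Ideal.span {z, w}
  equation : z ^ 2 * (1 + w ^ 2 - z ^ 2) = algebraMap K O d * w ^ 2
  exists_const : ∀ g : O, ∃ c : K, g - algebraMap K O c ∈ maximalIdeal O
  indep : ∀ a b : K, algebraMap K O a * z + algebraMap K O b * w ∈ maximalIdeal O ^ 2 → a = 0 ∧ b = 0
  regular : w ∈ nonZeroDivisors O

namespace IsNode

variable {O : Type*} [CommRing O] [IsLocalRing O] [Algebra K O] {d : K} {z w : O}

theorem z_mem (h : IsNode d z w) : z ∈ maximalIdeal O :=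
  h.maximal ▸ Ideal.subset_span (by simp)

theorem w_mem (h : IsNode d z w) : w ∈ maximalIdeal O :=
  h.maximal ▸ Ideal.subset_span (by simp)

/-- An element that is congruent to a nonzero constant is a unit. -/
theorem isUnit_of_sub_mem {g : O} {c : K} (hc : c ≠ 0)
    (hg : g - algebraMap K O c ∈ maximalIdeal O) : IsUnit g := by
  by_contra hu
  have h1 : algebraMap K O c ∈ maximalIdeal O := by
    have := (maximalIdeal O).sub_mem ((mem_maximalIdeal g).2 hu) hg
    rwa [sub_sub_cancel] at this
  exact (mem_maximalIdeal _).1 h1 ((IsUnit.mk0 c hc).map _)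

/-- `z² = v w²` where `v` is congruent to `d`. -/
theorem exists_sq_eq (h : IsNode d z w) :
    ∃ v : O, z ^ 2 = v * w ^ 2 ∧ v - algebraMap K O d ∈ maximalIdeal O := by
  have hmem : w ^ 2 - z ^ 2 ∈ maximalIdeal O :=
    Ideal.sub_mem _ (Ideal.pow_mem_of_mem _ h.w_mem 2 two_pos)
      (Ideal.pow_mem_of_mem _ h.z_mem 2 two_pos)
  have hu : IsUnit (1 + w ^ 2 - z ^ 2) := by
    refine isUnit_of_sub_mem (K := K) one_ne_zero ?_
    rw [map_one]
    convert hmem using 1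
    ring
  obtain ⟨u, hu⟩ := hu
  have h1 : (1 + w ^ 2 - z ^ 2) * (↑u⁻¹ : O) = 1 := by rw [← hu, Units.mul_inv]
  refine ⟨algebraMap K O d * ↑u⁻¹, ?_, ?_⟩
  · linear_combination (↑u⁻¹ : O) * h.equation - z ^ 2 * h1
  · have : algebraMap K O d * ↑u⁻¹ - algebraMap K O d
        = (-(algebraMap K O d) * ↑u⁻¹) * (w ^ 2 - z ^ 2) := by
      linear_combination algebraMap K O d * h1
    rw [this]
    exact Ideal.mul_mem_left _ _ hmem

theorem exists_eq_add (h : IsNode d z w) {b : O} (hb : b ∈ maximalIdeal O) :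
    ∃ g g' : O, b = g * z + g' * w := by
  rw [h.maximal, Ideal.mem_span_pair] at hb
  obtain ⟨g, g', rfl⟩ := hb
  exact ⟨g, g', rfl⟩

/-- The square of the maximal ideal is `w` times the maximal ideal. -/
theorem exists_mul_eq (h : IsNode d z w) {a b : O} (ha : a ∈ maximalIdeal O)
    (hb : b ∈ maximalIdeal O) : ∃ c ∈ maximalIdeal O, a * b = w * c := by
  obtain ⟨g, g', rfl⟩ := h.exists_eq_add ha
  obtain ⟨k, k', rfl⟩ := h.exists_eq_add hb
  obtain ⟨v, hv, -⟩ := h.exists_sq_eq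
  refine ⟨(g * k * v + g' * k') * w + (g * k' + g' * k) * z, Ideal.add_mem _
    (Ideal.mul_mem_left _ _ h.w_mem) (Ideal.mul_mem_left _ _ h.z_mem), ?_⟩
  linear_combination g * k * hv

/-- Modulo `w` times the maximal ideal, an element of the maximal ideal is linear in `z` and `w`. -/
theorem exists_linear_part (h : IsNode d z w) {b : O} (hb : b ∈ maximalIdeal O) :
    ∃ (α β : K) (c : O), c ∈ maximalIdeal O ∧
      b = algebraMap K O α * z + algebraMap K O β * w + w * c := by
  obtain ⟨g, g', rfl⟩ := h.exists_eq_add hb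
  obtain ⟨α, hα⟩ := h.exists_const g
  obtain ⟨β, hβ⟩ := h.exists_const g'
  obtain ⟨c, hc, hc'⟩ := h.exists_mul_eq hα h.z_mem
  refine ⟨α, β, c + (g' - algebraMap K O β), Ideal.add_mem _ hc hβ, ?_⟩
  linear_combination hc'

/-- An element of order one would generate the maximal ideal, which needs two generators. -/
theorem two_le_ord (h : IsNode d z w) {b : O} (hb : b ∈ maximalIdeal O) : 2 ≤ Ring.ord O b := by
  by_contra! hlt
  have hle : Ring.ord O b ≤ 1 := by
    rwa [← one_add_one_eq_two, ENat.lt_add_one_iff (by simp)] at hlt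
  have hne : Ideal.span {b} ≠ ⊤ := fun htop =>
    (mem_maximalIdeal b).1 hb (Ideal.span_singleton_eq_top.1 htop)
  have h1 : Ring.ord O b = 1 := by
    refine le_antisymm hle (Order.one_le_iff_ne_zero.2 fun h0 => hne ?_)
    rw [Ring.ord, Module.length_eq_zero_iff, Submodule.Quotient.subsingleton_iff] at h0
    exact h0
  rw [Ring.ord, Module.length_eq_one_iff, isSimpleModule_iff_isCoatom] at h1
  have hmax : maximalIdeal O = Ideal.span {b} := (eq_maximalIdeal ⟨h1⟩).symm
  obtain ⟨r, hr⟩ := Ideal.mem_span_singleton'.1 (hmax ▸ h.z_mem)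
  obtain ⟨s, hs⟩ := Ideal.mem_span_singleton'.1 (hmax ▸ h.w_mem)
  obtain ⟨α, hα⟩ := h.exists_const r
  obtain ⟨β, hβ⟩ := h.exists_const s
  -- `z ≡ α b` and `w ≡ β b`, so `β z - α w` lies in the square of the maximal ideal.
  have key : algebraMap K O β * z + algebraMap K O (-α) * w ∈ maximalIdeal O ^ 2 := by
    have : algebraMap K O β * z + algebraMap K O (-α) * w
        = (algebraMap K O β * (r - algebraMap K O α) - algebraMap K O α * (s - algebraMap K O β))
          * b := by
      rw [← hr, ← hs, map_neg]; ring
    rw [this, sq]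
    exact Ideal.mul_mem_mul (Ideal.sub_mem _ (Ideal.mul_mem_left _ _ hα) (Ideal.mul_mem_left _ _ hβ)) hb
  obtain ⟨hβ0, hα0⟩ := h.indep _ _ key
  rw [neg_eq_zero] at hα0
  have key2 : algebraMap K O 1 * z + algebraMap K O 0 * w ∈ maximalIdeal O ^ 2 := by
    rw [hα0, map_zero, sub_zero] at hα
    rw [map_one, map_zero, zero_mul, add_zero, one_mul, ← hr, sq]
    exact Ideal.mul_mem_mul hα hb
  exact one_ne_zero (h.indep _ _ key2).1

/-- The quotient by `w` is spanned by `1` and `z`. -/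
theorem ord_w (h : IsNode d z w) : Ring.ord O w = 2 := by
  refine le_antisymm ?_ (h.two_le_ord h.w_mem)
  let f : (Fin 2 → K) →ₗ[K] O ⧸ Ideal.span {w} :=
    Fintype.linearCombination K ![1, Ideal.Quotient.mk _ z]
  have hf : Function.Surjective f := by
    intro y
    obtain ⟨g, rfl⟩ := Ideal.Quotient.mk_surjective y
    obtain ⟨c, hc⟩ := h.exists_const g
    obtain ⟨α, β, e, -, he⟩ := h.exists_linear_part hc
    refine ⟨![c, α], ?_⟩
    have hg : g = algebraMap K O c * 1 + algebraMap K O α * z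
        + (algebraMap K O β + e) * w := by linear_combination he
    have hw : Ideal.Quotient.mk (Ideal.span {w}) w = 0 :=
      Ideal.Quotient.eq_zero_iff_mem.2 (Ideal.mem_span_singleton_self w)
    rw [hg, map_add, map_mul, hw, mul_zero, add_zero]
    simp only [f, Fintype.linearCombination_apply, Fin.sum_univ_two, Matrix.cons_val_zero,
      Matrix.cons_val_one, Algebra.smul_def, map_add, map_mul, map_one]
    rfl
  calc Ring.ord O w ≤ Module.length K (O ⧸ Ideal.span {w}) := by
        rw [Ring.ord, ← Module.length_top, ← Module.length_top (R := K)]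
        exact Submodule.length_le_length_restrictScalars K ⊤
    _ ≤ Module.length K (Fin 2 → K) := Module.length_le_of_surjective f hf
    _ = 2 := by rw [Module.length_eq_finrank, Module.finrank_fin_fun]; rfl

theorem z_regular (h : IsNode d z w) (hd : d ≠ 0) : z ∈ nonZeroDivisors O := by
  obtain ⟨v, hv, hvd⟩ := h.exists_sq_eq
  have : z * z ∈ nonZeroDivisors O := by
    rw [← sq, hv]
    exact mul_mem (isUnit_of_sub_mem hd hvd).mem_nonZeroDivisors (pow_mem h.regular 2)
  exact (mul_mem_nonZeroDivisors.1 this).1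

theorem ord_z (h : IsNode d z w) (hd : d ≠ 0) : Ring.ord O z = 2 := by
  obtain ⟨v, hv, hvd⟩ := h.exists_sq_eq
  have h1 : Ring.ord O (z ^ 2) = Ring.ord O (w ^ 2) := by
    rw [hv, Ring.ord_mul_of_isUnit_left (isUnit_of_sub_mem hd hvd)]
  rw [Ring.ord_pow (h.z_regular hd), Ring.ord_pow h.regular, h.ord_w] at h1
  generalize Ring.ord O z = n at h1
  induction n with
  | top => simp at h1; exact absurd h1 (by decide)
  | coe n =>
    have h2 : 2 * n = 2 * 2 := by
      rw [nsmul_eq_mul, nsmul_eq_mul] at h1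
      exact_mod_cast h1
    have : n = 2 := by omega
    rw [this]; rfl

/-- When the two branches of the node are conjugate, every order of vanishing is even. -/
theorem even_ord (h : IsNode d z w) (hd : ¬ IsSquare d) (b : O) : Even (Ring.ord O b).toNat := by
  -- An element without linear part is `w` times an element of smaller order, and `w` has order two.
  have main : ∀ (n : ℕ) (b : O), Even (Ring.ord O b).toNat ∨ (2 * n : ℕ) ≤ Ring.ord O b := by
    intro n
    induction n with
    | zero => intro b; right; simp
    | succ n ih =>
      intro b
      by_cases hb : b ∈ maximalIdeal O
      · obtain ⟨α, β, c, hc, hbc⟩ := h.exists_linear_part hb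
        by_cases hαβ : α = 0 ∧ β = 0
        · obtain ⟨rfl, rfl⟩ := hαβ
          rw [map_zero, zero_mul, zero_mul, zero_add, zero_add] at hbc
          rw [hbc, Ring.ord_mul' _ h.regular, h.ord_w]
          rcases ih c with hc' | hc'
          · generalize Ring.ord O c = m at hc'
            induction m with
            | top => left; simp
            | coe m =>
              left
              have : ((2 : ℕ∞) + (m : ℕ∞)).toNat = 2 + m := by
                have : (2 : ℕ∞) + (m : ℕ∞) = ((2 + m : ℕ) : ℕ∞) := by simp
                rw [this, ENat.toNat_natCast]
              rw [this]
              exact even_two.add (by simpa using hc')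
          · right
            calc ((2 * (n + 1) : ℕ) : ℕ∞) = 2 + ((2 * n : ℕ) : ℕ∞) := by push_cast; ring
              _ ≤ _ := by gcongr
        · left
          -- Multiplying by the conjugate of the linear part gives a unit times `w²`.
          obtain ⟨v, hv, hvd⟩ := h.exists_sq_eq
          obtain ⟨b', hb'⟩ : ∃ b', b' = algebraMap K O α * z - algebraMap K O β * w := ⟨_, rfl⟩
          have hb'm : b' ∈ maximalIdeal O := hb' ▸
            Ideal.sub_mem _ (Ideal.mul_mem_left _ _ h.z_mem) (Ideal.mul_mem_left _ _ h.w_mem)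
          obtain ⟨e, he, hce⟩ := h.exists_mul_eq hc hb'm
          have hprod : b * b' = (algebraMap K O α ^ 2 * v - algebraMap K O β ^ 2 + e) * w ^ 2 := by
            rw [hbc]
            linear_combination (algebraMap K O α * z + algebraMap K O β * w) * hb'
              + algebraMap K O α ^ 2 * hv + w * hce
          have hne : α ^ 2 * d - β ^ 2 ≠ 0 := by
            intro h0
            by_cases hα : α = 0
            · subst hα
              refine hαβ ⟨rfl, ?_⟩
              simpa using h0
            · exact hd ⟨β / α, by field_simp; linear_combination h0⟩
          have hu : IsUnit (algebraMap K O α ^ 2 * v - algebraMap K O β ^ 2 + e) := by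
            refine isUnit_of_sub_mem hne ?_
            have : algebraMap K O α ^ 2 * v - algebraMap K O β ^ 2 + e
                - algebraMap K O (α ^ 2 * d - β ^ 2)
                = algebraMap K O α ^ 2 * (v - algebraMap K O d) + e := by
              simp only [map_sub, map_mul, map_pow]; ring
            rw [this]
            exact Ideal.add_mem _ (Ideal.mul_mem_left _ _ hvd) he
          have hreg : b * b' ∈ nonZeroDivisors O := by
            rw [hprod]
            exact mul_mem hu.mem_nonZeroDivisors (pow_mem h.regular 2)
          have hord := Ring.ord_mul O (a := b) (mul_mem_nonZeroDivisors.1 hreg).2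
          rw [hprod, Ring.ord_mul_of_isUnit_left hu, Ring.ord_pow h.regular, h.ord_w] at hord
          have h1 := h.two_le_ord hb
          have h2 := h.two_le_ord hb'm
          generalize Ring.ord O b = m at hord h1
          generalize Ring.ord O b' = m' at hord h2
          induction m with
          | top => simp
          | coe m =>
            induction m' with
            | top => simp at hord; exact absurd hord (by decide)
            | coe m' =>
              have h3 : 2 * 2 = m + m' := by
                rw [nsmul_eq_mul] at hord
                exact_mod_cast hord
              have h4 : 2 ≤ m := by exact_mod_cast h1
              have h5 : 2 ≤ m' := by exact_mod_cast h2
              have : m = 2 := by omega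
              simp [this]
      · left
        rw [Ring.ord_of_isUnit (by simpa using hb)]
        simp
  rcases eq_or_ne (Ring.ord O b) ⊤ with htop | htop
  · simp [htop]
  · rcases main ((Ring.ord O b).toNat + 1) b with h1 | h1
    · exact h1
    · exfalso
      obtain ⟨m, hm⟩ := ENat.ne_top_iff_exists.1 htop
      rw [← hm] at h1
      simp only [ENat.toNat_natCast, Nat.cast_le] at h1
      omega

end IsNode

end Nodes

section Infinity

/-! ### The points at infinity are nodes -/

/-- The equation of the curve in the two charts at infinity. -/
def nodeForm (d : K) : MvPolynomial (Fin 2) K :=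
  X 0 ^ 2 + X 1 ^ 2 * X 0 ^ 2 - X 0 ^ 4 - C d * X 1 ^ 2

theorem dehom_one_form (d : K) : dehom 1 (form d) = nodeForm d := by
  have h1 : (Fin.insertNth (1 : Fin 3) (1 : MvPolynomial (Fin 2) K) X : Fin 3 → _) 0 = X 0 := rfl
  have h2 : (Fin.insertNth (1 : Fin 3) (1 : MvPolynomial (Fin 2) K) X : Fin 3 → _) 2 = X 1 := rfl
  simp only [form, nodeForm, dehom, map_sub, map_add, map_mul, map_pow, aeval_X, algHom_C, h1, h2,
    Fin.insertNth_apply_same, algebraMap_eq]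
  ring

theorem dehom_two_form (d : K) : dehom 2 (form d) = nodeForm d := by
  have h1 : (Fin.insertNth (2 : Fin 3) (1 : MvPolynomial (Fin 2) K) X : Fin 3 → _) 0 = X 0 := rfl
  have h2 : (Fin.insertNth (2 : Fin 3) (1 : MvPolynomial (Fin 2) K) X : Fin 3 → _) 1 = X 1 := rfl
  simp only [form, nodeForm, dehom, map_sub, map_add, map_mul, map_pow, aeval_X, algHom_C, h1, h2,
    Fin.insertNth_apply_same, algebraMap_eq]
  ring

section Origin

variable {d : K} {i : Fin 3}

instance (hp : aeval (0 : Fin 2 → K) (dehom i (form d)) = 0) : (idealAt d i 0 hp).IsMaximal :=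
  idealAt_isMaximal d i 0 hp

/-- The local ring at the origin of a chart. It is a type of its own, so that instance search does
not unfold the localization. -/
def OriginRing (d : K) (i : Fin 3) (hp : aeval (0 : Fin 2 → K) (dehom i (form d)) = 0) :
    Type _ :=
  Localization.AtPrime (idealAt d i 0 hp)

variable (hp : aeval (0 : Fin 2 → K) (dehom i (form d)) = 0)

instance : CommRing (OriginRing d i hp) :=
  inferInstanceAs (CommRing (Localization.AtPrime (idealAt d i 0 hp)))

instance : Algebra (Chart d i) (OriginRing d i hp) :=
  inferInstanceAs (Algebra (Chart d i) (Localization.AtPrime (idealAt d i 0 hp)))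

instance : Algebra K (OriginRing d i hp) :=
  inferInstanceAs (Algebra K (Localization.AtPrime (idealAt d i 0 hp)))

instance : IsScalarTower K (Chart d i) (OriginRing d i hp) :=
  inferInstanceAs (IsScalarTower K (Chart d i) (Localization.AtPrime (idealAt d i 0 hp)))

instance : IsLocalization.AtPrime (OriginRing d i hp) (idealAt d i 0 hp) :=
  inferInstanceAs (IsLocalization.AtPrime (Localization.AtPrime (idealAt d i 0 hp)) _)

instance : IsLocalRing (OriginRing d i hp) :=
  inferInstanceAs (IsLocalRing (Localization.AtPrime (idealAt d i 0 hp)))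

/-- The germ at the origin of a polynomial function on a chart. -/
def originGerm : MvPolynomial (Fin 2) K →ₐ[K] OriginRing d i hp :=
  (IsScalarTower.toAlgHom K (Chart d i) (OriginRing d i hp)).comp
    (Ideal.Quotient.mkₐ K (Ideal.span {dehom i (form d)}))

theorem originGerm_apply (f : MvPolynomial (Fin 2) K) :
    originGerm hp f = algebraMap (Chart d i) (OriginRing d i hp) (Ideal.Quotient.mk _ f) := rfl

theorem originGerm_form : originGerm hp (dehom i (form d)) = 0 := by
  rw [originGerm_apply, Ideal.Quotient.eq_zero_iff_mem.2 (Ideal.mem_span_singleton_self _), map_zero]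

theorem mk_mem_idealAt (f : MvPolynomial (Fin 2) K) :
    Ideal.Quotient.mk (Ideal.span {dehom i (form d)}) f ∈ idealAt d i 0 hp ↔
      aeval (0 : Fin 2 → K) f = 0 := Iff.rfl

theorem mem_span_of_aeval_eq_zero {p : Fin 2 → K} {f : MvPolynomial (Fin 2) K}
    (hf : aeval p f = 0) :
    f ∈ Ideal.span {(X 0 - C (p 0) : MvPolynomial (Fin 2) K), X 1 - C (p 1)} := by
  have key : ∀ g : MvPolynomial (Fin 2) K,
      g - C (aeval p g) ∈ Ideal.span {(X 0 - C (p 0) : MvPolynomial (Fin 2) K), X 1 - C (p 1)} := by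
    intro g
    induction g using MvPolynomial.induction_on with
    | C a => simp
    | add q r hq hr =>
      convert Ideal.add_mem _ hq hr using 1
      rw [map_add, C_add]; ring
    | mul_X q j hq =>
      have hj : X j - C (p j) ∈
          Ideal.span {(X 0 - C (p 0) : MvPolynomial (Fin 2) K), X 1 - C (p 1)} := by
        apply Ideal.subset_span
        fin_cases j <;> simp
      convert Ideal.add_mem _ (Ideal.mul_mem_left _ q hj) (Ideal.mul_mem_left _ (C (p j)) hq) using 1
      rw [map_mul, aeval_X, C_mul]; ring
  simpa [hf] using key f

/-- The tangent vector `(a, b)` at the origin, as a map to the dual numbers. -/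
def tangent (hφ : dehom i (form d) = nodeForm d) (a b : K) : OriginRing d i hp →+* DualNumber K :=
  let f : MvPolynomial (Fin 2) K →ₐ[K] DualNumber K :=
    aeval ![a • DualNumber.eps, b • DualNumber.eps]
  let g : Chart d i →ₐ[K] DualNumber K := Ideal.Quotient.liftₐ _ f (by
    intro r hr
    obtain ⟨s, rfl⟩ := Ideal.mem_span_singleton.1 hr
    have h0 : f (dehom i (form d)) = 0 := by
      rw [hφ]
      simp [f, nodeForm, pow_succ]
    rw [map_mul, h0, zero_mul])
  IsLocalization.lift (M := (idealAt d i 0 hp).primeCompl) (g := g.toRingHom) (by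
    rintro ⟨s, hs⟩
    obtain ⟨s, rfl⟩ := Ideal.Quotient.mk_surjective s
    have h1 : (TrivSqZeroExt.fstHom K K K).comp f = aeval (0 : Fin 2 → K) := by
      ext j; fin_cases j <;> simp [f]
    rw [TrivSqZeroExt.isUnit_iff_isUnit_fst]
    have h2 : (g (Ideal.Quotient.mk _ s)).fst = aeval (0 : Fin 2 → K) s := DFunLike.congr_fun h1 s
    refine IsUnit.mk0 _ fun h0 => hs ?_
    exact (mk_mem_idealAt hp s).2 (h2.symm.trans h0))

theorem tangent_originGerm (hφ : dehom i (form d) = nodeForm d) (a b : K)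
    (f : MvPolynomial (Fin 2) K) :
    tangent hp hφ a b (originGerm hp f)
      = aeval ![a • DualNumber.eps, b • DualNumber.eps] f := by
  rw [originGerm_apply, tangent, IsLocalization.lift_eq]
  rfl

theorem node_equation {S : Type*} [CommRing S] {z w c : S}
    (h : 0 = z ^ 2 + w ^ 2 * z ^ 2 - z ^ 4 - c * w ^ 2) : z ^ 2 * (1 + w ^ 2 - z ^ 2) = c * w ^ 2 := by
  linear_combination -h

/-- The linear parts of the elements of the local ring are detected by its maps to the dual numbers;
`w` is regular because the equation of the curve is not divisible by it. -/
theorem isNode_originRing (hφ : dehom i (form d) = nodeForm d) :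
    IsNode d (originGerm hp (X 0)) (originGerm hp (X 1)) := by
  have hmax : maximalIdeal (OriginRing d i hp)
      = Ideal.span {originGerm hp (X 0), originGerm hp (X 1)} := by
    apply le_antisymm
    · rw [← IsLocalization.AtPrime.map_eq_maximalIdeal (idealAt d i 0 hp), Ideal.map_le_iff_le_comap]
      intro g hg
      obtain ⟨f, rfl⟩ := Ideal.Quotient.mk_surjective g
      have hf := mem_span_of_aeval_eq_zero ((mk_mem_idealAt hp f).1 hg)
      simp only [Pi.zero_apply, C_0, sub_zero] at hf
      obtain ⟨r, s, rfl⟩ := Ideal.mem_span_pair.1 hf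
      rw [Ideal.mem_comap, ← originGerm_apply, map_add, map_mul, map_mul]
      exact Ideal.mem_span_pair.2 ⟨_, _, rfl⟩
    · rw [← IsLocalization.AtPrime.map_eq_maximalIdeal (idealAt d i 0 hp), Ideal.span_le]
      rintro _ (rfl | rfl)
      · exact Ideal.mem_map_of_mem _ ((mk_mem_idealAt hp _).2 (by simp))
      · exact Ideal.mem_map_of_mem _ ((mk_mem_idealAt hp _).2 (by simp))
  have htan : ∀ a b : K, ∀ g ∈ maximalIdeal (OriginRing d i hp), ∃ t,
      tangent hp hφ a b g = t * DualNumber.eps := by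
    intro a b g hg
    rw [hmax] at hg
    obtain ⟨r, s, rfl⟩ := Ideal.mem_span_pair.1 hg
    refine ⟨tangent hp hφ a b r * algebraMap K _ a + tangent hp hφ a b s * algebraMap K _ b, ?_⟩
    rw [map_add, map_mul, map_mul, tangent_originGerm, tangent_originGerm]
    simp [Algebra.smul_def]
    ring
  have hconst : ∀ a b c : K, tangent hp hφ a b (algebraMap K _ c) = algebraMap K _ c := by
    intro a b c
    have : algebraMap K (OriginRing d i hp) c = originGerm hp (C c) :=
      ((originGerm hp).commutes c).symm
    rw [this, tangent_originGerm, aeval_C]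
  refine ⟨hmax, ?_, ?_, ?_, ?_⟩
  · have h := congrArg (originGerm hp) hφ
    rw [originGerm_form] at h
    simp only [nodeForm, map_sub, map_add, map_mul, map_pow] at h
    have hc : originGerm hp (C d) = algebraMap K _ d := (originGerm hp).commutes d
    rw [hc] at h
    exact node_equation h
  · intro g
    refine ⟨(tangent hp hφ 0 0 g).fst, ?_⟩
    rw [mem_maximalIdeal, mem_nonunits_iff]
    intro hu
    have h1 := hu.map (tangent hp hφ 0 0)
    rw [map_sub, hconst, TrivSqZeroExt.isUnit_iff_isUnit_fst] at h1
    simp [TrivSqZeroExt.algebraMap_eq_inl] at h1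
  · intro a b hab
    have key : ∀ u v : K, a * u + b * v = 0 := by
      intro u v
      have h0 : tangent hp hφ u v
          (algebraMap K _ a * originGerm hp (X 0) + algebraMap K _ b * originGerm hp (X 1)) = 0 := by
        generalize algebraMap K _ a * originGerm hp (X 0) + algebraMap K _ b * originGerm hp (X 1) = q
          at hab
        rw [sq] at hab
        induction hab using Submodule.mul_induction_on' with
        | mem_mul_mem m hm n hn =>
          obtain ⟨t, ht⟩ := htan u v m hm
          obtain ⟨t', ht'⟩ := htan u v n hn
          rw [map_mul, ht, ht']
          linear_combination t * t' * DualNumber.eps_mul_eps (R := K)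
        | add x _ y _ hx hy => rw [map_add, hx, hy, add_zero]
      rw [map_add, map_mul, map_mul, hconst, hconst, tangent_originGerm, tangent_originGerm] at h0
      have h1 := congrArg TrivSqZeroExt.snd h0
      simpa [TrivSqZeroExt.algebraMap_eq_inl, mul_comm] using h1
    exact ⟨by simpa using key 1 0, by simpa using key 0 1⟩
  · refine IsLocalization.map_nonZeroDivisors_le (idealAt d i 0 hp).primeCompl _
      (Submonoid.mem_map_of_mem _ ?_)
    rw [mem_nonZeroDivisors_iff_right]
    intro g hg
    obtain ⟨f, rfl⟩ := Ideal.Quotient.mk_surjective g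
    change Ideal.Quotient.mk _ (f * X 1) = 0 at hg
    rw [Ideal.Quotient.eq_zero_iff_mem, Ideal.mem_span_singleton, hφ] at hg
    obtain ⟨q, hq⟩ := hg
    have hdvd : (X 1 : MvPolynomial (Fin 2) K) ∣ nodeForm d * q := ⟨f, by rw [← hq]; ring⟩
    rcases (X_prime (R := K) (i := (1 : Fin 2))).dvd_or_dvd hdvd with ⟨r, hr⟩ | ⟨r, rfl⟩
    · exfalso
      have h1 := congrArg (aeval ![(Polynomial.X : Polynomial K), 0]) hr
      simp [nodeForm] at h1
      have h2 := congrArg (Polynomial.coeff · 2) h1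
      simp [Polynomial.coeff_X_pow] at h2
    · rw [Ideal.Quotient.eq_zero_iff_mem, Ideal.mem_span_singleton, hφ]
      refine ⟨r, ?_⟩
      have hX : (X 1 : MvPolynomial (Fin 2) K) ≠ 0 := X_ne_zero _
      apply mul_right_cancel₀ hX
      rw [hq]; ring

end Origin

/-! ### Changes of sign of the coordinates -/

theorem aeval_mul_of_isHomogeneous {σ S : Type*} [CommRing S] [Algebra K S] {n : ℕ}
    {G : MvPolynomial σ K} (hG : G.IsHomogeneous n) (c : S) (g : σ → S) :
    aeval (fun j => c * g j) G = c ^ n * aeval g G := by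
  rw [G.as_sum, map_sum, map_sum, Finset.mul_sum]
  refine Finset.sum_congr rfl fun m hm => ?_
  have hdeg : ∑ i ∈ m.support, m i = n := by
    rw [← hG (mem_support_iff.1 hm), Finsupp.weight_apply]
    simp [Finsupp.sum]
  rw [aeval_monomial, aeval_monomial, ← hdeg]
  simp only [Finsupp.prod, mul_pow, Finset.prod_mul_distrib, Finset.prod_pow_eq_pow_sum]
  ring

/-- The change of signs `X_j ↦ ε_j X_j` of the homogeneous coordinates. -/
def signs (ε : Fin 3 → K) : MvPolynomial (Fin 3) K →ₐ[K] MvPolynomial (Fin 3) K :=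
  aeval fun j => C (ε j) * X j

theorem signs_form (d : K) {ε : Fin 3 → K} (hε : ∀ j, ε j ^ 2 = 1) :
    signs ε (form d) = form d := by
  have h : ∀ j, (C (ε j) : MvPolynomial (Fin 3) K) ^ 2 = 1 := fun j => by
    rw [← map_pow, hε, map_one]
  have h4 : (C (ε 0) : MvPolynomial (Fin 3) K) ^ 4 = 1 := by
    rw [show 4 = 2 * 2 from rfl, pow_mul, h, one_pow]
  simp only [signs, form, map_sub, map_add, map_mul, map_pow, aeval_X, algHom_C, algebraMap_eq,
    mul_pow, h, h4, one_mul]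

/-- The change of signs of the coordinates of a chart that is induced by `signs ε`. -/
def chartSigns (i : Fin 3) (ε : Fin 3 → K) : MvPolynomial (Fin 2) K →ₐ[K] MvPolynomial (Fin 2) K :=
  aeval fun k => C (ε i * ε (i.succAbove k)) * X k

theorem dehom_signs (i : Fin 3) {ε : Fin 3 → K} (hε : ∀ j, ε j ^ 2 = 1) {n : ℕ}
    {G : MvPolynomial (Fin 3) K} (hG : G.IsHomogeneous n) :
    dehom i (signs ε G) = C (ε i) ^ n * chartSigns i ε (dehom i G) := by
  have h1 : (dehom i).comp (signs ε)
      = aeval fun j => C (ε i) * (C (ε i * ε j) *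
          (i.insertNth (1 : MvPolynomial (Fin 2) K) X : Fin 3 → MvPolynomial (Fin 2) K) j) := by
    ext1 j
    have hc : ∀ c : K, dehom i (C c) = C c := fun c => by simp [dehom, algebraMap_eq]
    simp only [AlgHom.comp_apply, signs, aeval_X, map_mul, hc]
    simp only [dehom, aeval_X]
    have : (C (ε i) : MvPolynomial (Fin 2) K) ^ 2 = 1 := by rw [← map_pow, hε, map_one]
    linear_combination - C (ε j) *
      (i.insertNth (1 : MvPolynomial (Fin 2) K) X : Fin 3 → MvPolynomial (Fin 2) K) j * this
  have h2 : (chartSigns i ε).comp (dehom i)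
      = aeval fun j => (C (ε i * ε j) *
          (i.insertNth (1 : MvPolynomial (Fin 2) K) X : Fin 3 → MvPolynomial (Fin 2) K) j) := by
    ext1 j
    simp only [AlgHom.comp_apply, dehom, aeval_X]
    revert j
    rw [Fin.forall_iff_succAbove i]
    constructor
    · simp [← sq, hε]
    · intro k
      simp [chartSigns]
  have h3 := DFunLike.congr_fun h1 G
  have h4 := DFunLike.congr_fun h2 G
  rw [AlgHom.comp_apply] at h3 h4
  rw [h3, h4, aeval_mul_of_isHomogeneous hG]

theorem form_isHomogeneous (d : K) : (form d).IsHomogeneous 4 := by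
  refine ((IsHomogeneous.add ?_ ?_).sub ?_).sub ?_
  · exact (isHomogeneous_X_pow _ 2).mul (isHomogeneous_X_pow _ 2)
  · exact (isHomogeneous_X_pow _ 2).mul (isHomogeneous_X_pow _ 2)
  · exact isHomogeneous_X_pow _ 4
  · exact ((isHomogeneous_X_pow _ 2).C_mul _).mul (isHomogeneous_X_pow _ 2)

/-- `chartSigns` as an automorphism. -/
def chartSignsEquiv (i : Fin 3) {ε : Fin 3 → K} (hε : ∀ j, ε j ^ 2 = 1) :
    MvPolynomial (Fin 2) K ≃ₐ[K] MvPolynomial (Fin 2) K :=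
  have h : (chartSigns i ε).comp (chartSigns i ε) = AlgHom.id K _ := by
    ext1 k
    have : (C (ε i * ε (i.succAbove k)) : MvPolynomial (Fin 2) K) ^ 2 = 1 := by
      rw [← map_pow, mul_pow, hε, hε, mul_one, map_one]
    simp only [chartSigns, AlgHom.comp_apply, aeval_X, map_mul, algHom_C, algebraMap_eq,
      AlgHom.id_apply]
    rw [← map_mul, ← mul_assoc, ← sq, this, one_mul]
  AlgEquiv.ofAlgHom (chartSigns i ε) (chartSigns i ε) h h

theorem chartSigns_form (d : K) (i : Fin 3) {ε : Fin 3 → K} (hε : ∀ j, ε j ^ 2 = 1) :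
    chartSigns i ε (dehom i (form d)) = dehom i (form d) := by
  have h := dehom_signs i hε (form_isHomogeneous d)
  have h4 : (C (ε i) : MvPolynomial (Fin 2) K) ^ 4 = 1 := by
    rw [← map_pow, show 4 = 2 * 2 from rfl, pow_mul, hε, one_pow, map_one]
  rw [signs_form d hε, h4, one_mul] at h
  exact h.symm

/-- A change of signs as an automorphism of a chart of the curve. -/
def chartAut (d : K) (i : Fin 3) {ε : Fin 3 → K} (hε : ∀ j, ε j ^ 2 = 1) :
    Chart d i ≃ₐ[K] Chart d i :=
  Ideal.quotientEquivAlg _ _ (chartSignsEquiv i hε) (by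
    rw [Ideal.map_span, Set.image_singleton]
    congr 2
    exact (chartSigns_form d i hε).symm)

theorem chartAut_mk (d : K) (i : Fin 3) {ε : Fin 3 → K} (hε : ∀ j, ε j ^ 2 = 1)
    (f : MvPolynomial (Fin 2) K) :
    chartAut d i hε (Ideal.Quotient.mk _ f) = Ideal.Quotient.mk _ (chartSigns i ε f) := rfl

theorem chartAut_mem_idealAt {d : K} {i : Fin 3}
    (hp : aeval (0 : Fin 2 → K) (dehom i (form d)) = 0) {ε : Fin 3 → K}
    (hε : ∀ j, ε j ^ 2 = 1) (g : Chart d i) :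
    chartAut d i hε g ∈ idealAt d i 0 hp ↔ g ∈ idealAt d i 0 hp := by
  obtain ⟨f, rfl⟩ := Ideal.Quotient.mk_surjective g
  rw [chartAut_mk, mk_mem_idealAt, mk_mem_idealAt]
  have : (aeval (0 : Fin 2 → K)).comp (chartSigns i ε) = aeval (0 : Fin 2 → K) := by
    ext j; simp [chartSigns]
  rw [← AlgHom.comp_apply, this]

/-- A change of signs as an automorphism of the local ring at the origin of a chart. -/
def originAut {d : K} {i : Fin 3} (hp : aeval (0 : Fin 2 → K) (dehom i (form d)) = 0)
    {ε : Fin 3 → K} (hε : ∀ j, ε j ^ 2 = 1) : OriginRing d i hp ≃+* OriginRing d i hp :=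
  IsLocalization.ringEquivOfRingEquiv (M := (idealAt d i 0 hp).primeCompl)
    (T := (idealAt d i 0 hp).primeCompl) _ _ (chartAut d i hε).toRingEquiv (by
      ext g
      rw [Submonoid.mem_map]
      constructor
      · rintro ⟨s, hs, rfl⟩
        exact fun h => hs ((chartAut_mem_idealAt hp hε s).1 h)
      · intro hg
        obtain ⟨s, rfl⟩ := (chartAut d i hε).surjective g
        exact ⟨s, fun h => hg ((chartAut_mem_idealAt hp hε s).2 h), rfl⟩)

theorem originAut_originGerm {d : K} {i : Fin 3}
    (hp : aeval (0 : Fin 2 → K) (dehom i (form d)) = 0) {ε : Fin 3 → K}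
    (hε : ∀ j, ε j ^ 2 = 1) (f : MvPolynomial (Fin 2) K) :
    originAut hp hε (originGerm hp f) = originGerm hp (chartSigns i ε f) := by
  rw [originGerm_apply, originAut, IsLocalization.ringEquivOfRingEquiv_eq]
  rfl

theorem ord_ringEquiv {R S : Type*} [CommRing R] [CommRing S] (e : R ≃+* S) (r : R) :
    Ring.ord S (e r) = Ring.ord R r := by
  let : Algebra R S := e.toRingHom.toAlgebra
  let f : (R ⧸ Ideal.span {r}) ≃+* S ⧸ Ideal.span {e r} :=
    Ideal.quotientEquiv _ _ e (by rw [Ideal.map_span, Set.image_singleton]; rfl)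
  let g : (R ⧸ Ideal.span {r}) ≃ₗ[R] S ⧸ Ideal.span {e r} :=
    { f.toAddEquiv with
      map_smul' := by
        intro a b
        obtain ⟨b, rfl⟩ := Ideal.Quotient.mk_surjective b
        change f (Ideal.Quotient.mk _ (a * b)) = Ideal.Quotient.mk _ (e a * e b)
        rw [← map_mul]
        rfl }
  rw [Ring.ord, Ring.ord, g.length_eq]
  exact (Module.length_eq_of_surjective (R := S) (S := R) e.surjective).symm

end Infinity

section Bezout

/-! ### Zeros of forms on the curve -/

/-- The restriction of a form to the affine curve. -/
def germ0 (d : K) : MvPolynomial (Fin 3) K →ₐ[K] Chart d 0 :=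
  (Ideal.Quotient.mkₐ K (Ideal.span {dehom 0 (form d)})).comp (dehom 0)

/-- The germ of a form at `Ω₁`. -/
def germ1 (d : K) : MvPolynomial (Fin 3) K →ₐ[K] OriginRing d 1 (origin_one d) :=
  (originGerm (origin_one d)).comp (dehom 1)

/-- The germ of a form at `Ω₂`. -/
def germ2 (d : K) : MvPolynomial (Fin 3) K →ₐ[K] OriginRing d 2 (origin_two d) :=
  (originGerm (origin_two d)).comp (dehom 2)

/-- The coordinate `Z / X` at `Ω₁`. -/
def z1 (d : K) : OriginRing d 1 (origin_one d) := originGerm (origin_one d) (X 0)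

/-- The coordinate `Y / X` at `Ω₁`. -/
def w1 (d : K) : OriginRing d 1 (origin_one d) := originGerm (origin_one d) (X 1)

/-- The coordinate `Z / Y` at `Ω₂`. -/
def z2 (d : K) : OriginRing d 2 (origin_two d) := originGerm (origin_two d) (X 0)

/-- The coordinate `X / Y` at `Ω₂`. -/
def w2 (d : K) : OriginRing d 2 (origin_two d) := originGerm (origin_two d) (X 1)

theorem isNode1 (d : K) : IsNode d (z1 d) (w1 d) := isNode_originRing _ (dehom_one_form d)

theorem isNode2 (d : K) : IsNode d (z2 d) (w2 d) := isNode_originRing _ (dehom_two_form d)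

theorem germ0_eq (d : K) : germ0 d = aeval ![1, xf d, yf d] := by
  have h1 : (Fin.insertNth (0 : Fin 3) (1 : MvPolynomial (Fin 2) K) X : Fin 3 → _) 1 = X 0 := rfl
  have h2 : (Fin.insertNth (0 : Fin 3) (1 : MvPolynomial (Fin 2) K) X : Fin 3 → _) 2 = X 1 := rfl
  apply MvPolynomial.algHom_ext
  intro j
  rw [aeval_X]
  change Ideal.Quotient.mk _ (aeval (Fin.insertNth (0 : Fin 3) (1 : MvPolynomial (Fin 2) K) X) (X j)) = _
  rw [aeval_X]
  fin_cases j
  · exact map_one _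
  · exact congrArg _ h1
  · exact congrArg _ h2

theorem germ1_eq (d : K) : germ1 d = aeval ![z1 d, 1, w1 d] := by
  ext j
  fin_cases j
  · have h : (Fin.insertNth (1 : Fin 3) (1 : MvPolynomial (Fin 2) K) X : Fin 3 → _) 0 = X 0 := rfl
    simp [germ1, dehom, h, z1]
  · simp [germ1, dehom]
  · have h : (Fin.insertNth (1 : Fin 3) (1 : MvPolynomial (Fin 2) K) X : Fin 3 → _) 2 = X 1 := rfl
    simp [germ1, dehom, h, w1]

theorem germ2_eq (d : K) : germ2 d = aeval ![z2 d, w2 d, 1] := by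
  ext j
  fin_cases j
  · have h : (Fin.insertNth (2 : Fin 3) (1 : MvPolynomial (Fin 2) K) X : Fin 3 → _) 0 = X 0 := rfl
    simp [germ2, dehom, h, z2]
  · have h : (Fin.insertNth (2 : Fin 3) (1 : MvPolynomial (Fin 2) K) X : Fin 3 → _) 1 = X 1 := rfl
    simp [germ2, dehom, h, w2]
  · simp [germ2, dehom]

/-- The order of vanishing of a form at `Ω₁`. -/
def ord1 (d : K) (G : MvPolynomial (Fin 3) K) : ℕ∞ :=
  Ring.ord (OriginRing d 1 (origin_one d)) (germ1 d G)

/-- The order of vanishing of a form at `Ω₂`. -/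
def ord2 (d : K) (G : MvPolynomial (Fin 3) K) : ℕ∞ :=
  Ring.ord (OriginRing d 2 (origin_two d)) (germ2 d G)

theorem order_affine (d : K) (m : MaximalSpectrum (Chart d 0)) (G : MvPolynomial (Fin 3) K) :
    (ClosedPoint.affine m).order G
      = Ring.ord (Localization.AtPrime m.asIdeal) (algebraMap _ _ (germ0 d G)) := rfl

theorem order_omega1 (d : K) (G : MvPolynomial (Fin 3) K) :
    (ClosedPoint.omega1 (d := d)).order G = ord1 d G :=
  rfl

theorem order_omega2 (d : K) (G : MvPolynomial (Fin 3) K) :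
    (ClosedPoint.omega2 (d := d)).order G = ord2 d G :=
  rfl

theorem germ0_form (d : K) : germ0 d (form d) = 0 :=
  Ideal.Quotient.eq_zero_iff_mem.2 (Ideal.mem_span_singleton_self _)

theorem germ1_form (d : K) : germ1 d (form d) = 0 := originGerm_form _

theorem germ2_form (d : K) : germ2 d (form d) = 0 := originGerm_form _

/-- The form `G` meets the curve properly: it is nonzero on the affine curve, and regular with
finite order of vanishing at the two points at infinity. -/
structure NonVanishing (d : K) (G : MvPolynomial (Fin 3) K) : Prop where
  affine : germ0 d G ≠ 0
  regular1 : germ1 d G ∈ nonZeroDivisors _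
  regular2 : germ2 d G ∈ nonZeroDivisors _
  finite1 : ord1 d G ≠ ⊤
  finite2 : ord2 d G ≠ ⊤

/-- The number of zeros of the form `G` on the curve, counted with multiplicities and degrees. -/
def zeroCount (d : K) (G : MvPolynomial (Fin 3) K) : ℕ :=
  Module.finrank K (Chart d 0 ⧸ Ideal.span {germ0 d G})
    + (ord1 d G).toNat + (ord2 d G).toNat

/-- `G` satisfies Bézout's theorem as a form of degree `n`: it meets the curve properly, in `4 n`
points. -/
structure HasBezout (d : K) (n : ℕ) (G : MvPolynomial (Fin 3) K) : Prop where
  nonVanishing : NonVanishing d G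
  count : zeroCount d G = 4 * n

/-- `HasBezout` depends only on the restriction of the form to the curve. -/
theorem HasBezout.congr {d : K} {n : ℕ} {G G' : MvPolynomial (Fin 3) K} (h : HasBezout d n G)
    (hG : form d ∣ G - G') : HasBezout d n G' := by
  obtain ⟨q, hq⟩ := hG
  have h0 : germ0 d G = germ0 d G' := by
    rw [← sub_eq_zero, ← map_sub, hq, map_mul, germ0_form, zero_mul]
  have h1 : germ1 d G = germ1 d G' := by
    rw [← sub_eq_zero, ← map_sub (germ1 d), hq, map_mul, germ1_form, zero_mul]
  have h2 : germ2 d G = germ2 d G' := by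
    rw [← sub_eq_zero, ← map_sub (germ2 d), hq, map_mul, germ2_form, zero_mul]
  have h1' : ord1 d G = ord1 d G' := by
    rw [ord1, ord1, h1]
  have h2' : ord2 d G = ord2 d G' := by
    rw [ord2, ord2, h2]
  refine ⟨⟨h0 ▸ h.1.1, h1 ▸ h.1.2, h2 ▸ h.1.3, h1' ▸ h.1.4, h2' ▸ h.1.5⟩, ?_⟩
  rw [← h.2, zeroCount, zeroCount, h0, h1', h2']

theorem ord_mul_ne_top_iff {R : Type*} [CommRing R] {a b : R} (hb : b ∈ nonZeroDivisors R) :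
    Ring.ord R (a * b) ≠ ⊤ ↔ Ring.ord R a ≠ ⊤ ∧ Ring.ord R b ≠ ⊤ := by
  rw [Ring.ord_mul R hb, Ne, ENat.add_eq_top, not_or]

theorem zeroCount_signs {d : K} {ε : Fin 3 → K} (hε : ∀ j, ε j ^ 2 = 1) {n : ℕ}
    {G : MvPolynomial (Fin 3) K} (hG : G.IsHomogeneous n) :
    zeroCount d (signs ε G) = zeroCount d G := by
  have hunit : ∀ (i : Fin 3) {S : Type _} [CommRing S] [Algebra K S],
      IsUnit (algebraMap K S (ε i) ^ n) := fun i S _ _ => by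
    refine IsUnit.pow n (IsUnit.map _ (IsUnit.mk0 _ ?_))
    intro h0
    have := hε i
    rw [h0] at this
    norm_num at this
  have h0 : germ0 d (signs ε G) = algebraMap K _ (ε 0) ^ n * chartAut d 0 hε (germ0 d G) := by
    rw [germ0, AlgHom.comp_apply, dehom_signs 0 hε hG, map_mul, map_pow]
    rfl
  have h1 : germ1 d (signs ε G)
      = algebraMap K _ (ε 1) ^ n * originAut (origin_one d) hε (germ1 d G) := by
    rw [germ1, AlgHom.comp_apply, dehom_signs 1 hε hG, map_mul, map_pow, AlgHom.comp_apply,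
      originAut_originGerm]
    rfl
  have h2 : germ2 d (signs ε G)
      = algebraMap K _ (ε 2) ^ n * originAut (origin_two d) hε (germ2 d G) := by
    rw [germ2, AlgHom.comp_apply, dehom_signs 2 hε hG, map_mul, map_pow, AlgHom.comp_apply,
      originAut_originGerm]
    rfl
  have e : (Chart d 0 ⧸ Ideal.span {germ0 d G}) ≃ₐ[K]
      Chart d 0 ⧸ Ideal.span {germ0 d (signs ε G)} :=
    Ideal.quotientEquivAlg _ _ (chartAut d 0 hε) (by
      rw [h0, Ideal.span_singleton_mul_left_unit (hunit 0), Ideal.map_span, Set.image_singleton]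
      rfl)
  rw [zeroCount, ord1, ord2, h1, h2, Ring.ord_mul_of_isUnit_left (hunit 1),
    Ring.ord_mul_of_isUnit_left (hunit 2), ord_ringEquiv, ord_ringEquiv,
    ← e.toLinearEquiv.finrank_eq]
  rfl

section Additivity

variable [NeZero (2 : K)] {d : K} [Fact (d * (d - 1) ≠ 0)]

theorem nonVanishing_mul_iff {G H : MvPolynomial (Fin 3) K} :
    NonVanishing d (G * H) ↔ NonVanishing d G ∧ NonVanishing d H := by
  constructor
  · rintro ⟨h0, h1, h2, h3, h4⟩
    rw [map_mul, mul_mem_nonZeroDivisors] at h1 h2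
    rw [map_mul, mul_ne_zero_iff] at h0
    rw [ord1, map_mul, ord_mul_ne_top_iff h1.2] at h3
    rw [ord2, map_mul, ord_mul_ne_top_iff h2.2] at h4
    exact ⟨⟨h0.1, h1.1, h2.1, h3.1, h4.1⟩, ⟨h0.2, h1.2, h2.2, h3.2, h4.2⟩⟩
  · rintro ⟨hG, hH⟩
    refine ⟨?_, ?_, ?_, ?_, ?_⟩
    · rw [map_mul]; exact mul_ne_zero hG.1 hH.1
    · rw [map_mul]; exact mul_mem hG.2 hH.2
    · rw [map_mul]; exact mul_mem hG.3 hH.3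
    · rw [ord1, map_mul, ord_mul_ne_top_iff hH.2]; exact ⟨hG.4, hH.4⟩
    · rw [ord2, map_mul, ord_mul_ne_top_iff hH.3]; exact ⟨hG.5, hH.5⟩

theorem zeroCount_mul {G H : MvPolynomial (Fin 3) K} (hG : NonVanishing d G)
    (hH : NonVanishing d H) : zeroCount d (G * H) = zeroCount d G + zeroCount d H := by
  have h1 : (ord1 d (G * H)).toNat = (ord1 d G).toNat + (ord1 d H).toNat := by
    rw [ord1, map_mul, Ring.ord_mul _ hH.2]; exact ENat.toNat_add hG.4 hH.4
  have h2 : (ord2 d (G * H)).toNat = (ord2 d G).toNat + (ord2 d H).toNat := by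
    rw [ord2, map_mul, Ring.ord_mul _ hH.3]; exact ENat.toNat_add hG.5 hH.5
  have h0 : Module.finrank K (Chart d 0 ⧸ Ideal.span {germ0 d (G * H)})
      = Module.finrank K (Chart d 0 ⧸ Ideal.span {germ0 d G})
        + Module.finrank K (Chart d 0 ⧸ Ideal.span {germ0 d H}) := by
    rw [map_mul, ← Ideal.span_singleton_mul_span_singleton]
    exact finrank_quotient_eq_add (by simpa using hG.1) (by simpa using hH.1)
  rw [zeroCount, h0, h1, h2, zeroCount, zeroCount]
  ring

theorem HasBezout.mul {n m : ℕ} {G H : MvPolynomial (Fin 3) K} (hG : HasBezout d n G)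
    (hH : HasBezout d m H) : HasBezout d (n + m) (G * H) :=
  ⟨nonVanishing_mul_iff.2 ⟨hG.1, hH.1⟩, by rw [zeroCount_mul hG.1 hH.1, hG.2, hH.2]; ring⟩

theorem HasBezout.of_mul_right {n m : ℕ} {G H : MvPolynomial (Fin 3) K}
    (hGH : HasBezout d (n + m) (G * H)) (hH : HasBezout d m H) : HasBezout d n G := by
  have hG := (nonVanishing_mul_iff.1 hGH.1).1
  refine ⟨hG, ?_⟩
  have h := zeroCount_mul hG hH.1
  rw [hGH.2, hH.2] at h
  omega

/-- Bézout's theorem for the product of a form and one of its conjugates implies it for the form. -/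
theorem HasBezout.of_mul_signs {ε : Fin 3 → K} (hε : ∀ j, ε j ^ 2 = 1) {n : ℕ}
    {G : MvPolynomial (Fin 3) K} (hG : G.IsHomogeneous n)
    (h : HasBezout d (n + n) (G * signs ε G)) : HasBezout d n G := by
  obtain ⟨h1, h2⟩ := nonVanishing_mul_iff.1 h.1
  refine ⟨h1, ?_⟩
  have := zeroCount_mul h1 h2
  rw [h.2, zeroCount_signs hε hG] at this
  omega

end Additivity

/-! ### Bézout's theorem for forms linear in `Y` -/

theorem aeval_sub_mem {O : Type*} [CommRing O] [Algebra K O] (m : Ideal O) {σ : Type*}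
    {g : σ → O} {c : σ → K} (h : ∀ j, g j - algebraMap K O (c j) ∈ m) (H : MvPolynomial σ K) :
    aeval g H - algebraMap K O (eval c H) ∈ m := by
  rw [← Ideal.Quotient.mk_eq_mk_iff_sub_mem]
  have h1 : (Ideal.Quotient.mkₐ K m).comp (aeval g)
      = ((Ideal.Quotient.mkₐ K m).comp (Algebra.ofId K O)).comp (aeval c) := by
    ext j
    simp only [AlgHom.comp_apply, aeval_X]
    exact (Ideal.Quotient.mk_eq_mk_iff_sub_mem _ _).2 (h j)
  exact DFunLike.congr_fun h1 H

theorem eval_homogenize_natDegree (t : Polynomial K) :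
    eval ![1, 0] (t.homogenize t.natDegree) = t.leadingCoeff := by
  rw [Polynomial.homogenize, map_sum, Finset.sum_eq_single (t.natDegree, 0)]
  · simp [eval_monomial, Finsupp.prod_fintype, Fin.prod_univ_two, Finsupp.update_eq_add_single]
  · rintro ⟨a, b⟩ hab hne
    have hb : b ≠ 0 := by
      rintro rfl
      have := (Finset.HasAntidiagonal.mem_antidiagonal.1 hab : a + 0 = t.natDegree)
      exact hne (by rw [← this, add_zero])
    simp [eval_monomial, Finsupp.prod_fintype, Fin.prod_univ_two, Finsupp.update_eq_add_single, hb]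
  · simp

/-- The binary form `Xᵏ p(X / Z)` of degree `k` in `X` and `Z` that is attached to a polynomial. -/
def binaryForm (p : Polynomial K) (k : ℕ) : MvPolynomial (Fin 3) K :=
  aeval ![X 1, X 0] (p.homogenize k)

/-- The form of degree `2 k` in `X²` and `Z²` that is attached to a polynomial. -/
def evenForm (p : Polynomial K) (k : ℕ) : MvPolynomial (Fin 3) K :=
  aeval ![X 1 ^ 2, X 0 ^ 2] (p.homogenize k)

theorem binaryForm_isHomogeneous (p : Polynomial K) (k : ℕ) :
    (binaryForm p k).IsHomogeneous k := by
  have h := (Polynomial.isHomogeneous_homogenize (n := k) p).aeval (n := 1)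
    (![X 1, X 0] : Fin 2 → MvPolynomial (Fin 3) K)
    (fun j => by fin_cases j <;> exact isHomogeneous_X _ _)
  rwa [one_mul] at h

theorem aeval_evenForm {S : Type*} [CommRing S] [Algebra K S] (p : Polynomial K) (k : ℕ)
    (g : Fin 3 → S) :
    aeval g (evenForm p k) = aeval ![g 1 ^ 2, g 0 ^ 2] (p.homogenize k) := by
  rw [evenForm, ← AlgHom.comp_apply]
  congr 1
  ext j; fin_cases j <;> simp

theorem aeval_binaryForm {S : Type*} [CommRing S] [Algebra K S] (p : Polynomial K) (k : ℕ)
    (g : Fin 3 → S) :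
    aeval g (binaryForm p k) = aeval ![g 1, g 0] (p.homogenize k) := by
  rw [binaryForm, ← AlgHom.comp_apply]
  congr 1
  ext j; fin_cases j <;> simp

/-- The form of degree `a + 1` that restricts to `A(x) + B(x) y` on the affine curve. -/
def mixedForm (A B : Polynomial K) (a : ℕ) : MvPolynomial (Fin 3) K :=
  binaryForm A a * X 0 + binaryForm B a * X 2

theorem mixedForm_isHomogeneous (A B : Polynomial K) (a : ℕ) :
    (mixedForm A B a).IsHomogeneous (a + 1) :=
  ((binaryForm_isHomogeneous A a).mul (isHomogeneous_X _ _)).add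
    ((binaryForm_isHomogeneous B a).mul (isHomogeneous_X _ _))

theorem toNat_ord_pow_mul {O : Type*} [CommRing O] {a u : O} (ha : a ∈ nonZeroDivisors O)
    (ha2 : Ring.ord O a = 2) (hu : IsUnit u) (n : ℕ) :
    a ^ n * u ∈ nonZeroDivisors O ∧ Ring.ord O (a ^ n * u) = (2 * n : ℕ) := by
  refine ⟨mul_mem (pow_mem ha n) hu.mem_nonZeroDivisors, ?_⟩
  rw [Ring.ord_mul_of_isUnit_right hu, Ring.ord_pow ha, ha2]
  push_cast
  rw [nsmul_eq_mul, mul_comm]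

variable {d : K}

/-- The count of zeros of a form that is, up to units, a power of `z` at `Ω₁` and of `w` at `Ω₂`. -/
theorem hasBezout_of_eq {n a b c : ℕ} {G : MvPolynomial (Fin 3) K} {u1 : OriginRing d 1 (origin_one d)}
    {u2 : OriginRing d 2 (origin_two d)} (hd : d ≠ 0)
    (h0 : germ0 d G ≠ 0) (hc : Module.finrank K (Chart d 0 ⧸ Ideal.span {germ0 d G}) = c)
    (h1 : germ1 d G = z1 d ^ a * u1) (hu1 : IsUnit u1)
    (h2 : germ2 d G = w2 d ^ b * u2) (hu2 : IsUnit u2) (hn : c + 2 * a + 2 * b = 4 * n) :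
    HasBezout d n G := by
  obtain ⟨hr1, ho1⟩ := toNat_ord_pow_mul ((isNode1 d).z_regular hd) ((isNode1 d).ord_z hd) hu1 a
  obtain ⟨hr2, ho2⟩ := toNat_ord_pow_mul (isNode2 d).regular (isNode2 d).ord_w hu2 b
  rw [← h1] at hr1 ho1
  rw [← h2] at hr2 ho2
  refine ⟨⟨h0, hr1, hr2, ?_, ?_⟩, ?_⟩
  · rw [ord1, ho1]; exact ENat.natCast_ne_top _
  · rw [ord2, ho2]; exact ENat.natCast_ne_top _
  · rw [zeroCount, hc, ord1, ord2, ho1, ho2, ENat.toNat_natCast,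
      ENat.toNat_natCast, hn]

theorem finrank_quotient_span_of_isUnit {f : Chart d 0} (hf : IsUnit f) :
    Module.finrank K (Chart d 0 ⧸ Ideal.span {f}) = 0 := by
  rw [Ideal.span_singleton_eq_top.2 hf]
  have : Subsingleton (Chart d 0 ⧸ (⊤ : Ideal (Chart d 0))) := Ideal.Quotient.subsingleton_iff.2 rfl
  exact Module.finrank_zero_of_subsingleton

theorem nontrivial_chart : Nontrivial (Chart d 0) := (evx_injective d).nontrivial

/-- Bézout's theorem for a form in `X²` and `Z²` that is not divisible by
`Z² - d X²`. With `j` the degree of `t`, it has `4 j` zeros on the affine curve; at `Ω₁` it is a unit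
times `z ^ (2 (k - j))`, and at `Ω₂`, where `z² = v w²` with `v ≡ d`, a unit times `w ^ (2 k)`. -/
theorem hasBezout_evenForm_of_eval_ne_zero (hd : d ≠ 0) {t : Polynomial K} {k : ℕ}
    (hk : t.natDegree ≤ k) (ht : t.eval d⁻¹ ≠ 0) : HasBezout d (2 * k) (evenForm t k) := by
  have ht0 : t ≠ 0 := by rintro rfl; simp at ht
  have hg0 : germ0 d (evenForm t k) = evx d (Polynomial.expand K 2 t) := by
    rw [germ0_eq, aeval_evenForm, Polynomial.aeval_homogenize_of_eq_one hk _ (by simp)]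
    simp [evx, Polynomial.expand_aeval]
  have hexp : Polynomial.expand K 2 t ≠ 0 := (Polynomial.expand_ne_zero two_pos).2 ht0
  have hcop : IsCoprime (Polynomial.expand K 2 t) (den d) := by
    have h1 : IsCoprime t (Polynomial.X - Polynomial.C d⁻¹) := by
      rw [isCoprime_comm, (Polynomial.irreducible_X_sub_C d⁻¹).coprime_iff_not_dvd,
        Polynomial.dvd_iff_isRoot]
      exact ht
    have h2 : IsCoprime t (1 - Polynomial.C d * Polynomial.X) := by
      have : (1 - Polynomial.C d * Polynomial.X : Polynomial K)
          = (Polynomial.X - Polynomial.C d⁻¹) * Polynomial.C (-d) := by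
        have h3 : (Polynomial.C d * Polynomial.C d⁻¹ : Polynomial K) = 1 := by
          rw [← Polynomial.C_mul, mul_inv_cancel₀ hd, Polynomial.C_1]
        rw [Polynomial.C_neg]
        linear_combination - h3
      rw [this]
      exact h1.mul_right (isCoprime_one_right.of_isCoprime_of_dvd_right
        (isUnit_iff_dvd_one.1 (Polynomial.isUnit_C.2 (IsUnit.mk0 _ (neg_ne_zero.2 hd)))))
    have h3 := h2.map (Polynomial.expand K 2).toRingHom
    have h4 : Polynomial.expand K 2 (1 - Polynomial.C d * Polynomial.X) = den d := by
      simp [den]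
    rw [← h4]
    exact h3
  have hfin := (finrank_quotient_evx hexp hcop).2
  rw [Polynomial.natDegree_expand, ← hg0] at hfin
  obtain ⟨v, hv, hvd⟩ := (isNode2 d).exists_sq_eq
  have hu2 : IsUnit (aeval ![1, v] (t.homogenize k)) := by
    refine IsNode.isUnit_of_sub_mem (c := eval ![1, d] (t.homogenize k)) ?_
      (aeval_sub_mem (O := OriginRing d 2 (origin_two d)) _ (fun j => ?_) _)
    · rw [Polynomial.eval_homogenize hk _ (by simpa using hd)]
      simpa using ⟨ht, fun h => absurd h hd⟩
    · fin_cases j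
      · simp
      · exact hvd
  have hu1 : IsUnit (aeval ![1, z1 d ^ 2] (t.homogenize t.natDegree)) := by
    refine IsNode.isUnit_of_sub_mem (c := eval ![1, 0] (t.homogenize t.natDegree)) ?_
      (aeval_sub_mem (O := OriginRing d 1 (origin_one d)) _ (fun j => ?_) _)
    · rw [eval_homogenize_natDegree]
      exact Polynomial.leadingCoeff_ne_zero.2 ht0
    · fin_cases j
      · simp
      · simpa using Ideal.pow_mem_of_mem _ (isNode1 d).z_mem 2 two_pos
  refine hasBezout_of_eq (c := t.natDegree * 2 * 2) (a := 2 * (k - t.natDegree)) (b := 2 * k) hd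
    ?_ ?_ ?_ hu1 ?_ hu2 ?_
  · rw [hg0]
    exact (map_ne_zero_iff _ (evx_injective d)).2 hexp
  · rw [hfin]; ring
  · have hH : t.homogenize k = t.homogenize t.natDegree * X 1 ^ (k - t.natDegree) := by
      have h := Polynomial.homogenize_mul t 1 (m := t.natDegree) (n := k - t.natDegree) le_rfl (by simp)
      rwa [mul_one, Nat.add_sub_cancel' hk, Polynomial.homogenize_one] at h
    rw [germ1_eq, aeval_evenForm]
    simp only [Matrix.cons_val_zero, Matrix.cons_val_one, one_pow]
    rw [hH, map_mul, map_pow, aeval_X, pow_mul]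
    simp [mul_comm]
  · have h := aeval_mul_of_isHomogeneous (Polynomial.isHomogeneous_homogenize (n := k) t)
      (w2 d ^ 2) ![1, v]
    rw [germ2_eq, aeval_evenForm, pow_mul, ← h]
    congr 2
    funext j
    fin_cases j
    · simp
    · simp [hv, mul_comm]
  · omega

/-- The even and odd parts of a polynomial. -/
theorem exists_expand_add (p : Polynomial K) :
    ∃ e o : Polynomial K, p = Polynomial.expand K 2 e + Polynomial.X * Polynomial.expand K 2 o := by
  induction p using Polynomial.induction_on' with
  | add p q hp hq =>
    obtain ⟨e, o, rfl⟩ := hp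
    obtain ⟨e', o', rfl⟩ := hq
    exact ⟨e + e', o + o', by simp only [map_add]; ring⟩
  | monomial n a =>
    rcases Nat.even_or_odd' n with ⟨m, rfl | rfl⟩
    · refine ⟨Polynomial.monomial m a, 0, ?_⟩
      simp [Polynomial.expand_monomial, mul_comm]
    · refine ⟨0, Polynomial.monomial m a, ?_⟩
      simp [Polynomial.expand_monomial, mul_comm]

variable [hd : Fact (d * (d - 1) ≠ 0)]

/-- The pair of lines `X² = d⁻¹ Z²` meets the affine curve nowhere, and has contact of order `8`
with the curve at `Ω₂`. -/
theorem hasBezout_lines : HasBezout d 2 (X 1 ^ 2 - C d⁻¹ * X 0 ^ 2) := by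
  have hd0 : d ≠ 0 := d_ne_zero
  have hn := nontrivial_chart (d := d)
  have hcd : ∀ {S : Type _} [CommRing S] [Algebra K S],
      algebraMap K S d * algebraMap K S d⁻¹ = 1 := fun {S} _ _ => by
    rw [← map_mul, mul_inv_cancel₀ hd0, map_one]
  obtain ⟨v, hv, hvd⟩ := (isNode2 d).exists_sq_eq
  have hv1 : IsUnit (v * (1 - v) * algebraMap K _ d⁻¹) := by
    refine ((IsNode.isUnit_of_sub_mem hd0 hvd).mul ?_).mul
      ((IsUnit.mk0 d⁻¹ (inv_ne_zero hd0)).map _)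
    refine IsNode.isUnit_of_sub_mem (c := 1 - d) ?_ ?_
    · rw [← neg_sub]; exact neg_ne_zero.2 (d_sub_one_ne_zero (d := d))
    · rw [map_sub, map_one]
      convert neg_mem hvd using 1
      ring
  have hg0 : IsUnit (germ0 d (X 1 ^ 2 - C d⁻¹ * X 0 ^ 2)) := by
    have : germ0 d (X 1 ^ 2 - C d⁻¹ * X 0 ^ 2) = algebraMap K _ (-d⁻¹) * evx d (den d) := by
      rw [evx_den, germ0_eq]
      simp
      linear_combination - xf d ^ 2 * hcd (S := Chart d 0)
    rw [this]
    exact ((IsUnit.mk0 _ (neg_ne_zero.2 (inv_ne_zero hd0))).map _).mul isUnit_den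
  refine hasBezout_of_eq (c := 0) (a := 0) (b := 4) (u1 := 1 - algebraMap K _ d⁻¹ * z1 d ^ 2)
    hd0 hg0.ne_zero (finrank_quotient_span_of_isUnit hg0) ?_ ?_ ?_ hv1 rfl
  · simp [germ1_eq]
  · refine IsNode.isUnit_of_sub_mem (K := K) one_ne_zero ?_
    rw [map_one, sub_sub_cancel_left]
    exact neg_mem (Ideal.mul_mem_left _ _
      (Ideal.pow_mem_of_mem _ (isNode1 d).z_mem 2 two_pos))
  · have h1 : germ2 d (X 1 ^ 2 - C d⁻¹ * X 0 ^ 2) = w2 d ^ 2 - algebraMap K _ d⁻¹ * z2 d ^ 2 := by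
      simp [germ2_eq]
    rw [h1]
    have h2 := (isNode2 d).equation
    have h3 := hcd (S := OriginRing d 2 (origin_two d))
    generalize z2 d = z at *
    generalize w2 d = w at *
    generalize algebraMap K (OriginRing d 2 (origin_two d)) d = D at *
    generalize algebraMap K (OriginRing d 2 (origin_two d)) d⁻¹ = D' at *
    linear_combination - w ^ 2 * h3 - D' * h2 + D' * (w ^ 2 - z ^ 2 - v * w ^ 2) * hv

variable [NeZero (2 : K)]

theorem hasBezout_Z : HasBezout d 1 (X 0) := by
  have hd0 : d ≠ 0 := d_ne_zero
  have hn := nontrivial_chart (d := d)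
  obtain ⟨v, hv, hvd⟩ := (isNode2 d).exists_sq_eq
  have h2 : HasBezout d (1 + 1) (X 0 * X 0) := by
    refine hasBezout_of_eq (c := 0) (a := 2) (b := 2) (u1 := 1) (u2 := v) hd0 ?_ ?_ ?_ isUnit_one ?_
      (IsNode.isUnit_of_sub_mem hd0 hvd) rfl
    · simp [germ0_eq]
    · exact finrank_quotient_span_of_isUnit (by simp [germ0_eq])
    · simp [germ1_eq, sq]
    · rw [mul_comm (w2 d ^ 2), ← hv]; simp [germ2_eq, sq]
  have h1 : NonVanishing d (X 0) := (nonVanishing_mul_iff.1 h2.1).1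
  refine ⟨h1, ?_⟩
  have := zeroCount_mul h1 h1
  rw [h2.2] at this
  omega

/-- Factors `Z² - d X²` are split off one by one. -/
theorem hasBezout_evenForm {s : Polynomial K} {k : ℕ} (hk : s.natDegree ≤ k) (hs : s ≠ 0) :
    HasBezout d (2 * k) (evenForm s k) := by
  have hd0 : d ≠ 0 := d_ne_zero
  induction k generalizing s with
  | zero =>
    refine hasBezout_evenForm_of_eval_ne_zero hd0 hk ?_
    rw [Polynomial.eq_C_of_natDegree_le_zero hk] at hs ⊢
    simpa using hs
  | succ k ih =>
    by_cases ht : s.eval d⁻¹ = 0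
    · obtain ⟨q, rfl⟩ := Polynomial.dvd_iff_isRoot.2 ht
      have hq := right_ne_zero_of_mul hs
      have hX := Polynomial.X_sub_C_ne_zero d⁻¹
      rw [Polynomial.natDegree_mul hX hq, Polynomial.natDegree_X_sub_C] at hk
      have hqk : q.natDegree ≤ k := by omega
      have h := (hasBezout_lines (d := d)).mul (ih hqk hq)
      have heq : evenForm ((Polynomial.X - Polynomial.C d⁻¹) * q) (k + 1)
          = (X 1 ^ 2 - C d⁻¹ * X 0 ^ 2) * evenForm q k := by
        rw [evenForm, add_comm k 1, Polynomial.homogenize_mul _ _ (by simp) hqk, map_mul]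
        congr 1
        simp [Polynomial.homogenize_X, algebraMap_eq]
      rw [heq]
      convert h using 1
      ring
    · exact hasBezout_evenForm_of_eval_ne_zero hd0 hk ht

/-- Bézout's theorem for binary forms in `X` and `Z`, by passing to the product of the form with
its conjugate under `X ↦ -X`. -/
theorem hasBezout_binaryForm {p : Polynomial K} {k : ℕ} (hk : p.natDegree ≤ k) (hp : p ≠ 0) :
    HasBezout d k (binaryForm p k) := by
  obtain ⟨e, o, heo⟩ := exists_expand_add p
  obtain ⟨s, hs⟩ : ∃ s, s = e ^ 2 - Polynomial.X * o ^ 2 := ⟨_, rfl⟩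
  have hX : (Polynomial.expand K 2) Polynomial.X = (Polynomial.X : Polynomial K) ^ 2 := by simp
  have hcomp : ∀ q : Polynomial K,
      (Polynomial.expand K 2 q).comp (-Polynomial.X) = Polynomial.expand K 2 q := fun q => by
    rw [Polynomial.expand_eq_comp_X_pow, Polynomial.comp_assoc]
    simp
  have hps : p * p.comp (-Polynomial.X) = Polynomial.expand K 2 s := by
    have : p.comp (-Polynomial.X)
        = Polynomial.expand K 2 e - Polynomial.X * Polynomial.expand K 2 o := by
      rw [heo, Polynomial.add_comp, Polynomial.mul_comp, hcomp, hcomp, Polynomial.X_comp]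
      ring
    rw [this, heo, hs]
    simp only [map_sub, map_mul, map_pow, hX]
    ring
  have hcdeg : (p.comp (-Polynomial.X)).natDegree = p.natDegree := by
    rw [Polynomial.natDegree_comp, Polynomial.natDegree_neg, Polynomial.natDegree_X, mul_one]
  have hc0 : p.comp (-Polynomial.X) ≠ 0 := by
    intro h
    have h1 := congrArg (fun q => q.comp (-Polynomial.X)) h
    simp only [Polynomial.comp_assoc, Polynomial.neg_comp, Polynomial.X_comp, neg_neg,
      Polynomial.comp_X, Polynomial.zero_comp] at h1
    exact hp h1
  have hs0 : s ≠ 0 := by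
    rintro rfl
    rw [map_zero] at hps
    exact mul_ne_zero hp hc0 hps
  have hsk : s.natDegree ≤ k := by
    have := congrArg Polynomial.natDegree hps
    rw [Polynomial.natDegree_mul hp hc0, hcdeg, Polynomial.natDegree_expand] at this
    omega
  let ε : Fin 3 → K := ![1, -1, 1]
  have hε : ∀ j, ε j ^ 2 = 1 := by intro j; fin_cases j <;> simp [ε]
  refine HasBezout.of_mul_signs hε (binaryForm_isHomogeneous p k) ?_
  have hconj : signs ε (binaryForm p k) = binaryForm (p.comp (-Polynomial.X)) k := by
    have h1 : (p.comp (-Polynomial.X)).homogenize k = aeval ![-X 0, X 1] (p.homogenize k) := by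
      apply Polynomial.homogenize_eq_of_isHomogeneous
      · have h := (Polynomial.isHomogeneous_homogenize (n := k) p).aeval (n := 1)
          (![-X 0, X 1] : Fin 2 → MvPolynomial (Fin 2) K)
          (fun j => by
            fin_cases j
            · exact (isHomogeneous_X _ _).neg
            · exact isHomogeneous_X _ _)
        rwa [one_mul] at h
      · rw [← AlgHom.comp_apply]
        have h2 : (aeval ![Polynomial.X, 1] : MvPolynomial (Fin 2) K →ₐ[K] Polynomial K).comp
            (aeval ![-X 0, X 1]) = aeval ![-Polynomial.X, 1] := by
          ext j; fin_cases j <;> simp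
        rw [h2, Polynomial.aeval_homogenize_of_eq_one hk _ (by simp)]
        simp [Polynomial.comp, Polynomial.aeval_def, Polynomial.algebraMap_eq]
    rw [signs, aeval_binaryForm, binaryForm, h1, ← AlgHom.comp_apply]
    congr 1
    ext j; fin_cases j <;> simp [ε]
  have hprod : binaryForm p k * signs ε (binaryForm p k) = evenForm s k := by
    have h1 : (Polynomial.expand K 2 s).homogenize (k + k)
        = aeval ![X 0 ^ 2, X 1 ^ 2] (s.homogenize k) := by
      apply Polynomial.homogenize_eq_of_isHomogeneous
      · have h := (Polynomial.isHomogeneous_homogenize (n := k) s).aeval (n := 2)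
          (![X 0 ^ 2, X 1 ^ 2] : Fin 2 → MvPolynomial (Fin 2) K)
          (fun j => by fin_cases j <;> exact isHomogeneous_X_pow _ _)
        rwa [two_mul] at h
      · rw [← AlgHom.comp_apply]
        have h2 : (aeval ![Polynomial.X, 1] : MvPolynomial (Fin 2) K →ₐ[K] Polynomial K).comp
            (aeval ![X 0 ^ 2, X 1 ^ 2]) = aeval ![Polynomial.X ^ 2, 1] := by
          ext j; fin_cases j <;> simp
        rw [h2, Polynomial.aeval_homogenize_of_eq_one hsk _ (by simp),
          Polynomial.expand_eq_comp_X_pow]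
        simp [Polynomial.comp, Polynomial.aeval_def, Polynomial.algebraMap_eq]
    rw [hconj, binaryForm, binaryForm, ← map_mul,
      ← Polynomial.homogenize_mul p (p.comp (-Polynomial.X)) hk (hcdeg.trans_le hk), hps, h1,
      evenForm, ← AlgHom.comp_apply]
    congr 1
    ext j; fin_cases j <;> simp
  rw [hprod, ← two_mul]
  exact hasBezout_evenForm hsk hs0

/-- Bézout's theorem for the forms that are linear in `Y`, by passing to the norm: modulo the
equation of the curve, the product of the form with its conjugate under `Y ↦ -Y` and with
`Z² - d X²` is `Z²` times a binary form. -/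
theorem hasBezout_mixedForm {A B : Polynomial K} {a : ℕ} (hA : A.natDegree ≤ a)
    (hB : B.natDegree ≤ a) (h : A ≠ 0 ∨ B ≠ 0) : HasBezout d (a + 1) (mixedForm A B a) := by
  have hd0 : d ≠ 0 := d_ne_zero
  let ε : Fin 3 → K := ![1, 1, -1]
  have hε : ∀ j, ε j ^ 2 = 1 := by intro j; fin_cases j <;> simp [ε]
  refine HasBezout.of_mul_signs hε (mixedForm_isHomogeneous A B a) ?_
  have hbin : ∀ p : Polynomial K, signs ε (binaryForm p a) = binaryForm p a := fun p => by
    rw [signs, aeval_binaryForm]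
    simp [ε, binaryForm]
  have hconj : signs ε (mixedForm A B a) = binaryForm A a * X 0 - binaryForm B a * X 2 := by
    rw [mixedForm, map_add, map_mul, map_mul, hbin, hbin]
    simp [signs, ε]
    ring
  have hlin : HasBezout d 2 (binaryForm (den d) 2) := by
    refine hasBezout_binaryForm (by rw [den]; compute_degree) ?_
    intro h0
    have := congrArg (Polynomial.eval 0) h0
    simp [den] at this
  refine HasBezout.of_mul_right (m := 2) ?_ hlin
  have hnorm : binaryForm (normPoly d A B) (a + a + 2)
      = binaryForm A a ^ 2 * binaryForm (den d) 2 - binaryForm B a ^ 2 * (X 0 ^ 2 - X 1 ^ 2) := by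
    have hAA : (A ^ 2).natDegree ≤ a + a := by
      refine Polynomial.natDegree_pow_le.trans ?_; omega
    have hBB : (B ^ 2).natDegree ≤ a + a := by
      refine Polynomial.natDegree_pow_le.trans ?_; omega
    have hnum2 : (num K).homogenize 2 = X 1 ^ 2 - X 0 ^ 2 := by
      rw [num, Polynomial.homogenize_sub, Polynomial.homogenize_one, Polynomial.homogenize_X_pow le_rfl]
      simp
    simp only [binaryForm]
    rw [normPoly, Polynomial.homogenize_sub,
      Polynomial.homogenize_mul _ _ hAA (by rw [den]; compute_degree),
      Polynomial.homogenize_mul _ _ hBB (by rw [num]; compute_degree), hnum2, sq A, sq B,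
      Polynomial.homogenize_mul _ _ hA hA, Polynomial.homogenize_mul _ _ hB hB]
    simp only [map_sub, map_mul, map_pow, aeval_X]
    simp
    ring
  have hdenform : binaryForm (den d) 2 = X 0 ^ 2 - C d * X 1 ^ 2 := by
    rw [binaryForm, den, Polynomial.homogenize_sub, Polynomial.homogenize_one,
      Polynomial.homogenize_C_mul, Polynomial.homogenize_X_pow le_rfl]
    simp [algebraMap_eq]
  have hdeg : (normPoly d A B).natDegree ≤ a + a + 2 := by
    rw [normPoly, den, num]
    refine (Polynomial.natDegree_sub_le _ _).trans (max_le ?_ ?_)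
    · refine Polynomial.natDegree_mul_le.trans (add_le_add ?_ (by compute_degree))
      refine Polynomial.natDegree_pow_le.trans ?_; omega
    · refine Polynomial.natDegree_mul_le.trans (add_le_add ?_ (by compute_degree))
      refine Polynomial.natDegree_pow_le.trans ?_; omega
  have hN := (hasBezout_binaryForm (d := d) hdeg
    (normPoly_ne_zero (d_sub_one_ne_zero (d := d)) h)).mul
      ((hasBezout_Z (d := d)).mul (hasBezout_Z (d := d)))
  have hN' : HasBezout d (a + 1 + (a + 1) + 2)
      (binaryForm (normPoly d A B) (a + a + 2) * (X 0 * X 0)) := by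
    convert hN using 1; ring
  refine hN'.congr ⟨binaryForm B a ^ 2, ?_⟩
  rw [hnorm, hconj, hdenform, mixedForm, form]
  ring

end Bezout

section Classes

/-! ### Divisor classes -/

/-- The principal divisors of degree zero. Every principal divisor has degree zero, but with this
intersection the degree of a class is defined without Bézout's theorem for arbitrary forms. -/
def Princ0 (d : K) : AddSubgroup (Divisor d) := Princ d ⊓ Div0 d

/-- The class of a divisor modulo principal divisors of degree zero. -/
def cl (d : K) : Divisor d →+ Divisor d ⧸ Princ0 d := QuotientAddGroup.mk' _

theorem cl_eq_iff {d : K} {D D' : Divisor d} : cl d D = cl d D' ↔ D - D' ∈ Princ0 d := by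
  rw [← sub_eq_zero, ← map_sub]
  exact QuotientAddGroup.eq_zero_iff _

theorem linEquiv_of_cl_eq {d : K} {D D' : Divisor d} (h : cl d D = cl d D') : LinEquiv D D' :=
  (cl_eq_iff.1 h).1

/-- The class of `Ω₁`. -/
def o1 (d : K) : Divisor d ⧸ Princ0 d := cl d (divOmega1 d)

/-- The class of `Ω₂`. -/
def o2 (d : K) : Divisor d ⧸ Princ0 d := cl d (divOmega2 d)

/-- The class of a rational point of the affine curve. -/
def pt {d : K} (P : AffinePoint d) : Divisor d ⧸ Princ0 d := cl d P.toDivisor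

/-- The degree of a divisor class. -/
def clDegree (d : K) : Divisor d ⧸ Princ0 d →+ ℤ :=
  QuotientAddGroup.lift _ (Divisor.degree d) fun _ h => h.2

theorem degree_divOmega1 (d : K) : Divisor.degree d (divOmega1 d) = 1 := by
  rw [divOmega1, degree_single, one_mul]
  exact_mod_cast finrank_quotient_idealAt d 1 0 (origin_one d)

theorem degree_divOmega2 (d : K) : Divisor.degree d (divOmega2 d) = 1 := by
  rw [divOmega2, degree_single, one_mul]
  exact_mod_cast finrank_quotient_idealAt d 2 0 (origin_two d)

theorem clDegree_o1 (d : K) : clDegree d (o1 d) = 1 := degree_divOmega1 d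

theorem clDegree_o2 (d : K) : clDegree d (o2 d) = 1 := degree_divOmega2 d

theorem clDegree_pt {d : K} (P : AffinePoint d) : clDegree d (pt P) = 1 := degree_toDivisor P

theorem ord_germ_Z_pow {d : K} (hd : d ≠ 0) (n : ℕ) :
    ord1 d (X 0 ^ n) = (2 * n : ℕ) ∧ ord2 d (X 0 ^ n) = (2 * n : ℕ) := by
  have h1 := (toNat_ord_pow_mul ((isNode1 d).z_regular hd) ((isNode1 d).ord_z hd) isUnit_one n).2
  have h2 := (toNat_ord_pow_mul ((isNode2 d).z_regular hd) ((isNode2 d).ord_z hd) isUnit_one n).2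
  rw [mul_one] at h1 h2
  constructor
  · rw [ord1, map_pow, germ1_eq, aeval_X]; exact h1
  · rw [ord2, map_pow, germ2_eq, aeval_X]; exact h2

section Smooth

variable [NeZero (2 : K)] {d : K} [hd : Fact (d * (d - 1) ≠ 0)]

/-- The divisor of zeros of a form of degree `n` is equivalent to `n` times the line section
`2 Ω₁ + 2 Ω₂` at infinity. -/
theorem HasBezout.cl_eq {n : ℕ} {G : MvPolynomial (Fin 3) K} (h : HasBezout d n G)
    (hG : G.IsHomogeneous n) :
    cl d (idealDiv (Ideal.span {germ0 d G}))
      = (2 * n - (ord1 d G).toNat : ℤ) • o1 d + (2 * n - (ord2 d G).toNat : ℤ) • o2 d := by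
  have hd0 : d ≠ 0 := d_ne_zero
  have hI : Ideal.span {germ0 d G} ≠ 0 := by simpa using h.1.1
  have hn := nontrivial_chart (d := d)
  have hZ0 : germ0 d (X 0 ^ n) = 1 := by simp [germ0_eq]
  have hform : ∀ F, germ0 d F ≠ 0 → ¬ form d ∣ F := by
    rintro F hF ⟨q, rfl⟩
    rw [map_mul, germ0_form, zero_mul] at hF
    exact hF rfl
  have hcl : cl d (idealDiv (Ideal.span {germ0 d G}))
      = cl d ((2 * n - (ord1 d G).toNat : ℤ) • divOmega1 d
        + (2 * n - (ord2 d G).toNat : ℤ) • divOmega2 d) := by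
    rw [cl_eq_iff]
    refine ⟨AddSubgroup.subset_closure
      ⟨n, G, X 0 ^ n, hG, isHomogeneous_X_pow _ _, hform _ h.1.1, hform _ (by simp [hZ0]), ?_⟩, ?_⟩
    · rintro (m | _ | _)
      · rw [order_affine, order_affine, hZ0, map_one, Ring.ord_one,
          ord_atPrime (maximalSpectrum_ne_bot m) h.1.1]
        simp [idealDiv_affine hI, divOmega1, divOmega2]
      · rw [order_omega1, order_omega1, (ord_germ_Z_pow hd0 n).1]
        simp [idealDiv_omega1, divOmega1, divOmega2]
      · rw [order_omega2, order_omega2, (ord_germ_Z_pow hd0 n).2]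
        simp [idealDiv_omega2, divOmega1, divOmega2]
    · have hcount := h.2
      rw [zeroCount] at hcount
      change Divisor.degree d (_ - _) = 0
      rw [map_sub, map_add, map_zsmul, map_zsmul, degree_divOmega1, degree_divOmega2,
        (degree_idealDiv hI).2]
      simp only [smul_eq_mul, mul_one]
      omega
  rw [hcl, map_add, map_zsmul, map_zsmul]
  rfl

end Smooth

theorem germ0_mixedForm {d : K} {A B : Polynomial K} {a : ℕ} (hA : A.natDegree ≤ a) (hB : B.natDegree ≤ a) :
    germ0 d (mixedForm A B a) = evx d A + evx d B * yf d := by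
  rw [germ0_eq, mixedForm, map_add, map_mul, map_mul, aeval_binaryForm, aeval_binaryForm,
    Polynomial.aeval_homogenize_of_eq_one hA _ (by simp),
    Polynomial.aeval_homogenize_of_eq_one hB _ (by simp)]
  simp [evx]

/-- Both `Z` and `Y` vanish at `Ω₁`. -/
theorem two_le_ord1_mixedForm {d : K} (A B : Polynomial K) (a : ℕ) : 2 ≤ ord1 d (mixedForm A B a) := by
  refine (isNode1 d).two_le_ord ?_
  have h0 : germ1 d (X 0) = z1 d := by simp [germ1_eq]
  have h2 : germ1 d (X 2) = w1 d := by simp [germ1_eq]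
  rw [mixedForm, map_add, map_mul, map_mul, h0, h2]
  exact Ideal.add_mem _ (Ideal.mul_mem_left _ _ (isNode1 d).z_mem)
    (Ideal.mul_mem_left _ _ (isNode1 d).w_mem)

/-- The `n`-th power of the maximal ideal consists of elements of order at least `2 n`, because
`m ^ (n + 1) = w ^ n m`. -/
theorem IsNode.two_mul_le_ord {O : Type*} [CommRing O] [IsLocalRing O] [Algebra K O] {d : K}
    {z w : O} (h : IsNode d z w) {n : ℕ} {b : O} (hb : b ∈ maximalIdeal O ^ n) :
    ((2 * n : ℕ) : ℕ∞) ≤ Ring.ord O b := by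
  have key : ∀ (n : ℕ) (b : O), b ∈ maximalIdeal O ^ (n + 1) →
      ∃ c ∈ maximalIdeal O, b = w ^ n * c := by
    intro n
    induction n with
    | zero => intro b hb; exact ⟨b, by simpa using hb, by simp⟩
    | succ n ih =>
      intro b hb
      rw [pow_succ] at hb
      induction hb using Submodule.mul_induction_on' with
      | mem_mul_mem r hr s hs =>
        obtain ⟨c, hc, rfl⟩ := ih r hr
        obtain ⟨c', hc', hcc⟩ := h.exists_mul_eq hc hs
        exact ⟨c', hc', by rw [mul_assoc, hcc]; ring⟩
      | add x _ y _ hx hy =>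
        obtain ⟨c, hc, rfl⟩ := hx
        obtain ⟨c', hc', rfl⟩ := hy
        exact ⟨c + c', Ideal.add_mem _ hc hc', by ring⟩
  cases n with
  | zero => simp
  | succ n =>
    obtain ⟨c, hc, rfl⟩ := key n b hb
    rw [Ring.ord_mul' O (pow_mem h.regular n), Ring.ord_pow h.regular, h.ord_w]
    calc ((2 * (n + 1) : ℕ) : ℕ∞) = n • 2 + 2 := by push_cast; rw [nsmul_eq_mul]; ring
      _ ≤ _ := by gcongr; exact h.two_le_ord hc

theorem aeval_mem_pow_of_isHomogeneous {O σ : Type*} [CommRing O] [Algebra K O] {m : Ideal O}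
    {g : σ → O} (hg : ∀ j, g j ∈ m) {n : ℕ} {H : MvPolynomial σ K} (hH : H.IsHomogeneous n) :
    aeval g H ∈ m ^ n := by
  rw [H.as_sum, map_sum]
  refine Ideal.sum_mem _ fun s hs => ?_
  have hdeg : ∑ i ∈ s.support, s i = n := by
    rw [← hH (mem_support_iff.1 hs), Finsupp.weight_apply]
    simp [Finsupp.sum]
  rw [aeval_monomial, ← hdeg, ← Finset.prod_pow_eq_pow_sum]
  exact Ideal.mul_mem_left _ _ (Ideal.prod_mem_prod fun i _ => Ideal.pow_mem_pow (hg i) _)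

/-- The binary forms of degree `a` in `X` and `Z` lie in the `a`-th power of the maximal ideal at
`Ω₂`. -/
theorem two_mul_le_ord2_mixedForm {d : K} (A B : Polynomial K) (a : ℕ) :
    ((2 * a : ℕ) : ℕ∞) ≤ ord2 d (mixedForm A B a) := by
  refine (isNode2 d).two_mul_le_ord ?_
  have hbin : ∀ p : Polynomial K, germ2 d (binaryForm p a) ∈ maximalIdeal _ ^ a := fun p => by
    rw [germ2_eq, aeval_binaryForm]
    refine aeval_mem_pow_of_isHomogeneous (fun j => ?_) (Polynomial.isHomogeneous_homogenize p)
    fin_cases j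
    · exact (isNode2 d).w_mem
    · exact (isNode2 d).z_mem
  rw [mixedForm, map_add, map_mul, map_mul]
  exact Ideal.add_mem _ (Ideal.mul_mem_right _ _ (hbin A)) (Ideal.mul_mem_right _ _ (hbin B))

section Smooth

variable [NeZero (2 : K)] {d : K} [hd : Fact (d * (d - 1) ≠ 0)]

/-- The divisor of zeros of a function `A(x) + B(x) y` on the affine curve: its degree, and its
class as a combination of the points at infinity. -/
theorem finrank_le_and_cl_eq {A B : Polynomial K} {a : ℕ} (hA : A.natDegree ≤ a)
    (hB : B.natDegree ≤ a) (h : A ≠ 0 ∨ B ≠ 0) :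
    Module.finrank K (Chart d 0 ⧸ Ideal.span {evx d A + evx d B * yf d}) ≤ 2 * a + 2 ∧
      ∃ p q : ℤ, cl d (idealDiv (Ideal.span {evx d A + evx d B * yf d})) = p • o1 d + q • o2 d := by
  have hb := hasBezout_mixedForm (d := d) hA hB h
  have hc := hb.cl_eq (mixedForm_isHomogeneous A B a)
  rw [germ0_mixedForm hA hB] at hc
  refine ⟨?_, _, _, hc⟩
  have h1 := two_le_ord1_mixedForm (d := d) A B a
  have h2 := two_mul_le_ord2_mixedForm (d := d) A B a
  have h3 := hb.2
  rw [zeroCount, germ0_mixedForm hA hB] at h3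
  have h4 : 2 ≤ (ord1 d (mixedForm A B a)).toNat := by
    rw [← ENat.natCast_toNat hb.1.4] at h1
    exact_mod_cast h1
  have h5 : 2 * a ≤ (ord2 d (mixedForm A B a)).toNat := by
    rw [← ENat.natCast_toNat hb.1.5] at h2
    exact_mod_cast h2
  omega

end Smooth

/-! ### Divisors of the functions `x - x₀` and `y - y₀` -/

namespace AffinePoint

variable {d : K}

/-- The point `(-x, y)`. -/
def negX (P : AffinePoint d) : AffinePoint d := ⟨-P.x, P.y, by linear_combination P.equation⟩

/-- The point `(x, -y)`. -/
def negY (P : AffinePoint d) : AffinePoint d := ⟨P.x, -P.y, by linear_combination P.equation⟩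

/-- The maximal ideal of a rational point of the affine curve. -/
def maxIdeal (P : AffinePoint d) : MaximalSpectrum (Chart d 0) :=
  ⟨idealAt d 0 ![P.x, P.y] P.aeval_eq_zero, idealAt_isMaximal _ _ _ _⟩

theorem maxIdeal_eq (P : AffinePoint d) :
    P.maxIdeal.asIdeal
      = Ideal.span {xf d - algebraMap K _ P.x, yf d - algebraMap K _ P.y} := by
  apply le_antisymm
  · intro g hg
    obtain ⟨f, rfl⟩ := Ideal.Quotient.mk_surjective g
    have hf : aeval ![P.x, P.y] f = 0 := hg
    obtain ⟨r, s, rfl⟩ := Ideal.mem_span_pair.1 (mem_span_of_aeval_eq_zero hf)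
    exact Ideal.mem_span_pair.2 ⟨Ideal.Quotient.mk _ r, Ideal.Quotient.mk _ s, rfl⟩
  · rw [Ideal.span_le]
    rintro _ (rfl | rfl)
    · change aeval ![P.x, P.y] (X 0 - C P.x) = 0
      simp
    · change aeval ![P.x, P.y] (X 1 - C P.y) = 0
      simp

end AffinePoint

/-- On the curve `u² + v² = 1 + d u² v²`, the function `u - a` cuts out the points `(a, b)` and
`(a, -b)`. -/
theorem span_sub_eq_mul {R : Type*} [CommRing R] {D u v a b : R}
    (huv : u ^ 2 + v ^ 2 = 1 + D * u ^ 2 * v ^ 2) (hab : a ^ 2 + b ^ 2 = 1 + D * a ^ 2 * b ^ 2)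
    (hu : IsUnit (1 - D * u ^ 2)) (hb : IsUnit (D * b ^ 2 - 1)) (h2 : IsUnit (2 : R))
    (h : IsUnit a ∨ IsUnit b) :
    Ideal.span {u - a} = Ideal.span {u - a, v - b} * Ideal.span {u - a, v - -b} := by
  have key : (1 - D * u ^ 2) * ((v - b) * (v - -b)) = (D * b ^ 2 - 1) * ((u - a) * (u + a)) := by
    linear_combination huv - hab
  rw [Ideal.span_pair_mul_span_pair]
  apply le_antisymm
  · rw [Ideal.span_singleton_le_iff_mem]
    obtain ⟨I, hI⟩ : ∃ I, I = Ideal.span {(u - a) * (u - a), (u - a) * (v - -b), (v - b) * (u - a),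
      (v - b) * (v - -b)} := ⟨_, rfl⟩
    rw [← hI]
    have h1 : (u - a) * (u - a) ∈ I := hI ▸ Ideal.subset_span (by simp)
    have h3 : (u - a) * (v - -b) ∈ I := hI ▸ Ideal.subset_span (by simp)
    have h4 : (v - b) * (u - a) ∈ I := hI ▸ Ideal.subset_span (by simp)
    have h5 : (v - b) * (v - -b) ∈ I := hI ▸ Ideal.subset_span (by simp)
    have h6 : (u - a) * (u + a) ∈ I := by
      rw [← Ideal.unit_mul_mem_iff_mem I hb, ← key]
      exact I.mul_mem_left _ h5
    rcases h with h | h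
    · rw [← Ideal.unit_mul_mem_iff_mem I (h2.mul h)]
      convert I.sub_mem h6 h1 using 1
      ring
    · rw [← Ideal.unit_mul_mem_iff_mem I (h2.mul h)]
      convert I.sub_mem h3 h4 using 1
      ring
  · rw [Ideal.span_le]
    have h1 : u - a ∈ Ideal.span {u - a} := Ideal.mem_span_singleton_self _
    rintro _ (rfl | rfl | rfl | rfl)
    · exact Ideal.mul_mem_left _ _ h1
    · exact Ideal.mul_mem_right _ _ h1
    · exact Ideal.mul_mem_left _ _ h1
    · rw [SetLike.mem_coe, ← Ideal.unit_mul_mem_iff_mem _ hu, key]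
      exact Ideal.mul_mem_left _ _ (Ideal.mul_mem_right _ _ h1)

theorem AffinePoint.finrank_maxIdeal {d : K} (P : AffinePoint d) :
    Module.finrank K (Chart d 0 ⧸ P.maxIdeal.asIdeal) = 1 := finrank_quotient_idealAt _ _ _ _

theorem AffinePoint.den_mul {d : K} (P : AffinePoint d) :
    (1 - d * P.x ^ 2) * (d * P.y ^ 2 - 1) = d - 1 := by
  linear_combination d * P.equation

theorem isUnit_two_chart [NeZero (2 : K)] {d : K} : IsUnit (2 : Chart d 0) := by
  have := (IsUnit.mk0 (2 : K) (NeZero.ne 2)).map (algebraMap K (Chart d 0))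
  rwa [map_ofNat] at this

theorem AffinePoint.isUnit_or {d : K} (P : AffinePoint d) :
    IsUnit (algebraMap K (Chart d 0) P.x) ∨ IsUnit (algebraMap K (Chart d 0) P.y) := by
  by_cases hx : P.x = 0
  · right
    refine (IsUnit.mk0 _ ?_).map _
    intro hy
    have := P.equation
    rw [hx, hy] at this
    norm_num at this
  · exact Or.inl ((IsUnit.mk0 _ hx).map _)

theorem AffinePoint.algebraMap_equation {d : K} (P : AffinePoint d) :
    algebraMap K (Chart d 0) P.x ^ 2 + algebraMap K (Chart d 0) P.y ^ 2
      = 1 + algebraMap K (Chart d 0) d * algebraMap K (Chart d 0) P.x ^ 2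
        * algebraMap K (Chart d 0) P.y ^ 2 := by
  have := congrArg (algebraMap K (Chart d 0)) P.equation
  simpa using this

section Smooth

variable [NeZero (2 : K)] {d : K} [hd : Fact (d * (d - 1) ≠ 0)]

theorem AffinePoint.idealDiv_maxIdeal (P : AffinePoint d) :
    idealDiv P.maxIdeal.asIdeal = P.toDivisor := idealDiv_maximal _

/-- The function `x - x₀` gives `(x₀, y₀) + (x₀, -y₀) ≡ 2 Ω₁`. -/
theorem pt_add_pt_negY (P : AffinePoint d) : pt P + pt P.negY = (2 : ℤ) • o1 d := by
  have hd0 : d ≠ 0 := d_ne_zero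
  have hmul := P.den_mul
  have h0 : (1 - d * P.x ^ 2) * (d * P.y ^ 2 - 1) ≠ 0 := hmul ▸ d_sub_one_ne_zero (d := d)
  have hu : IsUnit (1 - algebraMap K (Chart d 0) d * xf d ^ 2) := evx_den d ▸ isUnit_den
  have hb : IsUnit (algebraMap K (Chart d 0) d * algebraMap K _ P.y ^ 2 - 1) := by
    have := (IsUnit.mk0 _ (right_ne_zero_of_mul h0)).map (algebraMap K (Chart d 0))
    simpa using this
  have hspan := span_sub_eq_mul (affine_equation d) P.algebraMap_equation hu hb isUnit_two_chart
    P.isUnit_or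
  have hneg : -algebraMap K (Chart d 0) P.y = algebraMap K _ P.negY.y := (map_neg _ _).symm
  rw [hneg, ← P.maxIdeal_eq] at hspan
  rw [show algebraMap K (Chart d 0) P.x = algebraMap K _ P.negY.x from rfl] at hspan
  rw [← P.negY.maxIdeal_eq] at hspan
  have hA : (Polynomial.X - Polynomial.C P.x : Polynomial K).natDegree ≤ 1 := by compute_degree
  have hf : evx d (Polynomial.X - Polynomial.C P.x) + evx d 0 * yf d
      = xf d - algebraMap K _ P.negY.x := by simp [evx]; rfl
  have hbz := hasBezout_mixedForm (d := d) hA (B := 0) (by simp)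
    (Or.inl (Polynomial.X_sub_C_ne_zero _))
  have hcl := hbz.cl_eq (mixedForm_isHomogeneous _ _ _)
  have hcount := hbz.2
  rw [zeroCount] at hcount
  rw [germ0_mixedForm hA (by simp), hf, hspan] at hcl hcount
  have hdeg := (degree_idealDiv (mul_ne_zero (prime_asIdeal P.maxIdeal).ne_zero
    (prime_asIdeal P.negY.maxIdeal).ne_zero)).2
  rw [idealDiv_mul (prime_asIdeal P.maxIdeal).ne_zero (prime_asIdeal P.negY.maxIdeal).ne_zero,
    P.idealDiv_maxIdeal, P.negY.idealDiv_maxIdeal] at hcl hdeg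
  rw [map_add, degree_toDivisor, degree_toDivisor] at hdeg
  -- At `Ω₁` the form is `Z / X` times a unit.
  have ho1 : ord1 d (mixedForm (Polynomial.X - Polynomial.C P.x) 0 1) = 2 := by
    have h1 : germ1 d (mixedForm (Polynomial.X - Polynomial.C P.x) 0 1)
        = (1 - algebraMap K _ P.x * z1 d) * z1 d := by
      rw [germ1_eq, mixedForm, map_add, map_mul, map_mul, aeval_binaryForm, aeval_binaryForm,
        Polynomial.homogenize_sub, Polynomial.homogenize_X one_ne_zero, Polynomial.homogenize_C]
      simp
    rw [ord1, h1, Ring.ord_mul_of_isUnit_left, (isNode1 d).ord_z hd0]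
    refine IsNode.isUnit_of_sub_mem (K := K) one_ne_zero ?_
    rw [map_one, sub_sub_cancel_left]
    exact neg_mem (Ideal.mul_mem_left _ _ (isNode1 d).z_mem)
  rw [ho1] at hcl hcount
  have h2 : (2 : ℕ∞).toNat = 2 := rfl
  rw [h2] at hcl hcount
  have ho2 : (ord2 d (mixedForm (Polynomial.X - Polynomial.C P.x) 0 1)).toNat = 4 := by omega
  rw [ho2, map_add] at hcl
  norm_num at hcl
  exact hcl

/-- The function `y - y₀` gives `(x₀, y₀) + (-x₀, y₀) ≡ 2 Ω₂`. -/
theorem pt_add_pt_negX (P : AffinePoint d) : pt P + pt P.negX = (2 : ℤ) • o2 d := by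
  have hmul := P.den_mul
  have h0 : (1 - d * P.x ^ 2) * (d * P.y ^ 2 - 1) ≠ 0 := hmul ▸ d_sub_one_ne_zero (d := d)
  have hu : IsUnit (1 - algebraMap K (Chart d 0) d * yf d ^ 2) := by
    have h1 : (1 - algebraMap K (Chart d 0) d * yf d ^ 2)
        * (algebraMap K (Chart d 0) d * xf d ^ 2 - 1) = algebraMap K _ (d - 1) := by
      rw [map_sub, map_one]
      linear_combination algebraMap K (Chart d 0) d * affine_equation d
    exact isUnit_of_mul_isUnit_left
      (h1 ▸ (IsUnit.mk0 _ (d_sub_one_ne_zero (d := d))).map (algebraMap K (Chart d 0)))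
  have hb : IsUnit (algebraMap K (Chart d 0) d * algebraMap K _ P.x ^ 2 - 1) := by
    have := (IsUnit.mk0 _ (neg_ne_zero.2 (left_ne_zero_of_mul h0))).map (algebraMap K (Chart d 0))
    simpa using this
  have hspan := span_sub_eq_mul (u := yf d) (v := xf d) (a := algebraMap K _ P.y)
    (b := algebraMap K _ P.x) (by linear_combination affine_equation d)
    (by linear_combination P.algebraMap_equation) hu hb isUnit_two_chart P.isUnit_or.symm
  have hneg : -algebraMap K (Chart d 0) P.x = algebraMap K _ P.negX.x := (map_neg _ _).symm
  rw [hneg, Set.pair_comm, ← P.maxIdeal_eq, Set.pair_comm] at hspan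
  rw [show algebraMap K (Chart d 0) P.y = algebraMap K _ P.negX.y from rfl] at hspan
  rw [← P.negX.maxIdeal_eq] at hspan
  have hA : (-Polynomial.C P.y : Polynomial K).natDegree ≤ 0 := by simp
  have hf : evx d (-Polynomial.C P.y) + evx d 1 * yf d
      = yf d - algebraMap K _ P.negX.y := by
    simp [evx, AffinePoint.negX]; ring
  have hbz := hasBezout_mixedForm (d := d) hA (B := 1) (by simp) (Or.inr one_ne_zero)
  have hcl := hbz.cl_eq (mixedForm_isHomogeneous _ _ _)
  have hcount := hbz.2
  rw [zeroCount] at hcount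
  rw [germ0_mixedForm hA (by simp), hf, hspan] at hcl hcount
  have hdeg := (degree_idealDiv (mul_ne_zero (prime_asIdeal P.maxIdeal).ne_zero
    (prime_asIdeal P.negX.maxIdeal).ne_zero)).2
  rw [idealDiv_mul (prime_asIdeal P.maxIdeal).ne_zero (prime_asIdeal P.negX.maxIdeal).ne_zero,
    P.idealDiv_maxIdeal, P.negX.idealDiv_maxIdeal] at hcl hdeg
  rw [map_add, degree_toDivisor, degree_toDivisor] at hdeg
  -- At `Ω₂` the form does not vanish.
  have ho2 : ord2 d (mixedForm (-Polynomial.C P.y) 1 0) = 0 := by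
    have h1 : germ2 d (mixedForm (-Polynomial.C P.y) 1 0) = 1 - algebraMap K _ P.y * z2 d := by
      rw [germ2_eq, mixedForm, map_add, map_mul, map_mul, aeval_binaryForm, aeval_binaryForm,
        Polynomial.homogenize_neg, Polynomial.homogenize_C, Polynomial.homogenize_one]
      simp
      ring
    rw [ord2, h1, Ring.ord_of_isUnit]
    refine IsNode.isUnit_of_sub_mem (K := K) one_ne_zero ?_
    rw [map_one, sub_sub_cancel_left]
    exact neg_mem (Ideal.mul_mem_left _ _ (isNode2 d).z_mem)
  rw [ho2] at hcl hcount
  have h2 : (0 : ℕ∞).toNat = 0 := rfl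
  rw [h2] at hcl hcount
  have ho1 : (ord1 d (mixedForm (-Polynomial.C P.y) 1 0)).toNat = 2 := by omega
  rw [ho1, map_add] at hcl
  norm_num at hcl
  exact hcl

end Smooth

end Classes

section Reduction

/-! ### Functions with few prescribed zeros -/

/-- A dimension count: an ideal of odd codimension `2a + 1` contains a nonzero function
`A(x) + B(x) y` with `A` and `B` of degree at most `a`. -/
theorem exists_mem_of_finrank {d : K} {I : Ideal (Chart d 0)} [Module.Finite K (Chart d 0 ⧸ I)]
    {a : ℕ} (h : Module.finrank K (Chart d 0 ⧸ I) = 2 * a + 1) :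
    ∃ A B : Polynomial K, A.natDegree ≤ a ∧ B.natDegree ≤ a ∧ (A ≠ 0 ∨ B ≠ 0) ∧
      evx d A + evx d B * yf d ∈ I := by
  let V := Polynomial.degreeLT K (a + 1)
  let φ : V × V →ₗ[K] Chart d 0 ⧸ I := (Ideal.Quotient.mkₐ K I).toLinearMap ∘ₗ
    LinearMap.coprod ((evx d).toLinearMap ∘ₗ V.subtype)
      (LinearMap.mulRight K (yf d) ∘ₗ (evx d).toLinearMap ∘ₗ V.subtype)
  have hV : Module.finrank K V = a + 1 := by
    rw [(Polynomial.degreeLTEquiv K (a + 1)).finrank_eq]; simp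
  have hfin : Module.Finite K V := Module.Finite.equiv (Polynomial.degreeLTEquiv K (a + 1)).symm
  have hker : φ.ker ≠ ⊥ := LinearMap.ker_ne_bot_of_finrank_lt (by
    rw [h, Module.finrank_prod, hV]; omega)
  obtain ⟨⟨A, B⟩, hmem, hne⟩ := Submodule.exists_mem_ne_zero_of_ne_bot hker
  have hdeg : ∀ C : V, (C : Polynomial K).natDegree ≤ a := fun C => by
    rcases eq_or_ne (C : Polynomial K) 0 with h0 | h0
    · simp [h0]
    · exact Nat.lt_succ_iff.1
        ((Polynomial.natDegree_lt_iff_degree_lt h0).2 (Polynomial.mem_degreeLT.1 C.2))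
  refine ⟨A, B, hdeg A, hdeg B, ?_, Ideal.Quotient.eq_zero_iff_mem.1 hmem⟩
  by_contra! hAB
  exact hne (Prod.ext (Subtype.ext hAB.1) (Subtype.ext hAB.2))

/-- An ideal of codimension one is the ideal of a rational point. -/
theorem exists_maxIdeal_of_finrank_eq_one {d : K} {J : Ideal (Chart d 0)}
    (h : Module.finrank K (Chart d 0 ⧸ J) = 1) : ∃ P : AffinePoint d, P.maxIdeal.asIdeal = J := by
  have hbij : Function.Bijective (algebraMap K (Chart d 0 ⧸ J)) :=
    Algebra.finrank_eq_one_iff_bijective_algebraMap.1 h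
  obtain ⟨x, hx⟩ := hbij.2 (Ideal.Quotient.mk J (xf d))
  obtain ⟨y, hy⟩ := hbij.2 (Ideal.Quotient.mk J (yf d))
  have heq : x ^ 2 + y ^ 2 = 1 + d * x ^ 2 * y ^ 2 := by
    apply hbij.1
    have := congrArg (Ideal.Quotient.mk J) (affine_equation d)
    simp only [map_add, map_mul, map_pow, map_one] at this ⊢
    rw [hx, hy]
    exact this
  have hJ : J ≠ ⊤ := by
    rintro rfl
    have : Subsingleton (Chart d 0 ⧸ (⊤ : Ideal (Chart d 0))) :=
      Ideal.Quotient.subsingleton_iff.2 rfl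
    rw [Module.finrank_zero_of_subsingleton] at h
    exact zero_ne_one h
  let P : AffinePoint d := ⟨x, y, heq⟩
  refine ⟨P, P.maxIdeal.isMaximal.eq_of_le hJ ?_⟩
  rw [P.maxIdeal_eq, Ideal.span_le]
  rintro _ (rfl | rfl)
  · exact Ideal.Quotient.eq.1 hx.symm
  · exact Ideal.Quotient.eq.1 hy.symm

section Smooth

variable [NeZero (2 : K)] {d : K} [hd : Fact (d * (d - 1) ≠ 0)]

/-- An effective divisor of odd degree on the affine curve is, up to the points at infinity,
equivalent to a rational point or to zero: a function vanishing on it with poles of the least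
possible order has at most one further zero on the affine curve. -/
theorem cl_idealDiv_of_odd {I : Ideal (Chart d 0)} (hI : I ≠ 0) {a : ℕ}
    (h : Module.finrank K (Chart d 0 ⧸ I) = 2 * a + 1) :
    ∃ p q : ℤ, cl d (idealDiv I) = p • o1 d + q • o2 d ∨
      ∃ P : AffinePoint d, cl d (idealDiv I) = pt P + p • o1 d + q • o2 d := by
  have := (degree_idealDiv hI).1
  obtain ⟨A, B, hA, hB, hne, hmem⟩ := exists_mem_of_finrank h
  obtain ⟨hle, p, q, hcl⟩ := finrank_le_and_cl_eq (d := d) hA hB hne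
  obtain ⟨J, hJ⟩ := Ideal.dvd_span_singleton.2 hmem
  have hf : Ideal.span {evx d A + evx d B * yf d} ≠ 0 := by
    rw [Ne, Ideal.zero_eq_bot, Ideal.span_singleton_eq_bot]
    intro h0
    obtain ⟨rfl, rfl⟩ := eq_zero_of_rep h0
    simp at hne
  rw [hJ] at hf hle hcl
  have hJ0 : J ≠ 0 := right_ne_zero_of_mul hf
  rw [finrank_quotient_eq_add hI hJ0, h] at hle
  rw [idealDiv_mul hI hJ0, map_add] at hcl
  have hJfin := (degree_idealDiv hJ0).1
  rcases Nat.le_one_iff_eq_zero_or_eq_one.1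
    (show Module.finrank K (Chart d 0 ⧸ J) ≤ 1 by omega) with h0 | h1
  · have hJtop : J = ⊤ := Ideal.Quotient.subsingleton_iff.1 (Module.finrank_zero_iff.1 h0)
    rw [hJtop, idealDiv_top, map_zero, add_zero] at hcl
    exact ⟨p, q, Or.inl hcl⟩
  · obtain ⟨P, rfl⟩ := exists_maxIdeal_of_finrank_eq_one h1
    rw [P.idealDiv_maxIdeal] at hcl
    refine ⟨p, q - 2, Or.inr ⟨P.negX, ?_⟩⟩
    have hX := pt_add_pt_negX P
    change _ + pt P = _ at hcl
    rw [eq_sub_of_add_eq hcl, eq_sub_of_add_eq' hX]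
    module

/-- Every divisor is equivalent to an effective divisor of the affine curve plus a combination of
the points at infinity. -/
theorem exists_cl_eq_idealDiv (D : Divisor d) :
    ∃ I : Ideal (Chart d 0), I ≠ 0 ∧ ∃ p q : ℤ, cl d D = cl d (idealDiv I) + p • o1 d + q • o2 d := by
  let T : Divisor d → Prop := fun D =>
    ∃ I : Ideal (Chart d 0), I ≠ 0 ∧ ∃ p q : ℤ, cl d D = cl d (idealDiv I) + p • o1 d + q • o2 d
  have htop : (⊤ : Ideal (Chart d 0)) ≠ 0 := by
    have := nontrivial_chart (d := d)
    exact top_ne_bot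
  have hinf : ∀ p q : ℤ, T (p • divOmega1 d + q • divOmega2 d) := fun p q =>
    ⟨⊤, htop, p, q, by rw [idealDiv_top, map_zero, zero_add, map_add, map_zsmul, map_zsmul]; rfl⟩
  have hzero : T 0 := by simpa using hinf 0 0
  have hadd : ∀ D E, T D → T E → T (D + E) := by
    rintro D E ⟨I, hI, p, q, h⟩ ⟨J, hJ, r, s, h'⟩
    refine ⟨I * J, mul_ne_zero hI hJ, p + r, q + s, ?_⟩
    rw [map_add, h, h', idealDiv_mul hI hJ, map_add]
    module
  have hpos : ∀ m : MaximalSpectrum (Chart d 0), T (Finsupp.single (.affine m) 1) := fun m =>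
    ⟨m.asIdeal, (prime_asIdeal m).ne_zero, 0, 0, by rw [idealDiv_maximal]; simp⟩
  -- A nonzero polynomial in `x` vanishing at `m` has a divisor of zeros `m + J`.
  have hneg : ∀ m : MaximalSpectrum (Chart d 0), T (-Finsupp.single (.affine m) 1) := fun m => by
    obtain ⟨g, hg, hgm⟩ :=
      exists_irreducible_mem m.isMaximal.isPrime (maximalSpectrum_ne_bot m)
    have hgm' : evx d g + evx d 0 * yf d ∈ m.asIdeal := by simpa using (hgm g).2 dvd_rfl
    obtain ⟨-, p, q, hcl⟩ := finrank_le_and_cl_eq (d := d) (A := g) (B := 0) le_rfl (by simp)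
      (Or.inl hg.ne_zero)
    have hf : Ideal.span {evx d g + evx d 0 * yf d} ≠ 0 := by
      rw [Ne, Ideal.zero_eq_bot, Ideal.span_singleton_eq_bot]
      intro h0
      exact hg.ne_zero (eq_zero_of_rep h0).1
    obtain ⟨J, hJ⟩ := Ideal.dvd_span_singleton.2 hgm'
    rw [hJ] at hf hcl
    have hm0 := (prime_asIdeal m).ne_zero
    have hJ0 : J ≠ 0 := right_ne_zero_of_mul hf
    rw [idealDiv_mul hm0 hJ0, map_add, idealDiv_maximal] at hcl
    refine ⟨J, hJ0, -p, -q, ?_⟩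
    rw [map_neg, eq_sub_of_add_eq hcl]
    module
  have hsingle : ∀ (P : ClosedPoint d) (n : ℤ), T (Finsupp.single P n) := by
    rintro (m | _ | _) n
    · induction n using Int.induction_on with
      | zero => simpa using hzero
      | succ n ih => rw [Finsupp.single_add]; exact hadd _ _ ih (hpos m)
      | pred n ih =>
        rw [Finsupp.single_sub, sub_eq_add_neg]
        exact hadd _ _ ih (hneg m)
    · simpa [divOmega1] using hinf n 0
    · simpa [divOmega2] using hinf 0 n
  exact Finsupp.induction_linear D hzero hadd hsingle

/-! ### Reduction to a rational point -/

theorem two_zsmul_pt_O : (2 : ℤ) • pt (ptO d) = (2 : ℤ) • o2 d := by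
  rw [← pt_add_pt_negX (ptO d), two_zsmul]
  congr 2
  ext <;> simp [ptO, AffinePoint.negX]

theorem pt_O_add_pt_O' : pt (ptO d) + pt (ptO' d) = (2 : ℤ) • o1 d := pt_add_pt_negY (ptO d)

theorem pt_H_add_pt_H' : pt (ptH d) + pt (ptH' d) = (2 : ℤ) • o2 d := pt_add_pt_negX (ptH d)

theorem four_zsmul_o1 : (4 : ℤ) • o1 d = (4 : ℤ) • o2 d := by
  have h' : (2 : ℤ) • pt (ptO' d) = (2 : ℤ) • o2 d := by
    rw [← pt_add_pt_negX (ptO' d), two_zsmul]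
    congr 2
    ext <;> simp [ptO', AffinePoint.negX]
  calc (4 : ℤ) • o1 d = (2 : ℤ) • ((2 : ℤ) • o1 d) := by module
    _ = (2 : ℤ) • pt (ptO d) + (2 : ℤ) • pt (ptO' d) := by rw [← pt_O_add_pt_O', zsmul_add]
    _ = _ := by rw [two_zsmul_pt_O, h']; module

/-- Translation by `2 Ω₂ - 2 Ω₁` is the map `(x, y) ↦ (-x, -y)`. -/
theorem exists_pt_eq_add (P : AffinePoint d) (k : ℤ) :
    ∃ P' : AffinePoint d, pt P' = pt P + (2 * k) • (o2 d - o1 d) := by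
  have h4 := four_zsmul_o1 (d := d)
  have h0 : (4 : ℤ) • (o2 d - o1 d) = 0 := by rw [zsmul_sub, h4, sub_self]
  obtain ⟨j, rfl | rfl⟩ := k.even_or_odd'
  · refine ⟨P, ?_⟩
    rw [show 2 * (2 * j) = j * 4 by ring, SemigroupAction.mul_smul, h0, smul_zero, add_zero]
  · refine ⟨P.negX.negY, ?_⟩
    have hX := pt_add_pt_negX P
    have hY := pt_add_pt_negY P.negX
    rw [eq_sub_of_add_eq' hY, eq_sub_of_add_eq' hX,
      show 2 * (2 * j + 1) = (j + 1) * 4 - 2 by ring, sub_zsmul, SemigroupAction.mul_smul, h0]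
    module

/-- The class is represented by one of the four kinds of reduced divisors of degree zero. -/
def IsReducedClass (c : Divisor d ⧸ Princ0 d) : Prop :=
  ∃ P : AffinePoint d, c = pt P - pt (ptO d) ∨
    c = (pt P - pt (ptO d)) + (o1 d - pt (ptO d)) ∨
    c = (pt P - pt (ptO d)) + (o2 d - pt (ptO d)) ∨
    c = (pt P - pt (ptO d)) + (o1 d - o2 d)

/-- Even multiples of `Ω₂ - Ω₁` are absorbed into the rational point. -/
theorem isReducedClass_of_sub {P : AffinePoint d} {p q : ℤ} (h : p + q = 0) :
    IsReducedClass (pt P - pt (ptO d) + p • o1 d + q • o2 d) := by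
  obtain rfl : p = -q := by omega
  obtain ⟨k, rfl | rfl⟩ := q.even_or_odd'
  · obtain ⟨P', hP'⟩ := exists_pt_eq_add P k
    refine ⟨P', Or.inl ?_⟩
    rw [hP']
    module
  · obtain ⟨P', hP'⟩ := exists_pt_eq_add P (k + 1)
    refine ⟨P', Or.inr (Or.inr (Or.inr ?_))⟩
    rw [hP']
    module

/-- The two multiples of `O` that the reduced form requires are traded for `2 Ω₂`. -/
theorem isReducedClass_of_add {P : AffinePoint d} {p q : ℤ} (h : p + q = -1) :
    IsReducedClass (pt P + p • o1 d + q • o2 d) := by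
  have hO := two_zsmul_pt_O (d := d)
  have h2 : ∀ c e : Divisor d ⧸ Princ0 d,
      (c - pt (ptO d)) + (e - pt (ptO d)) = c + e - (2 : ℤ) • o2 d := fun c e => by
    rw [← hO]; module
  obtain rfl : q = -1 - p := by omega
  obtain ⟨k, rfl | rfl⟩ := p.even_or_odd'
  · obtain ⟨P', hP'⟩ := exists_pt_eq_add P (-k)
    refine ⟨P', Or.inr (Or.inr (Or.inl ?_))⟩
    rw [h2, hP']
    module
  · obtain ⟨P', hP'⟩ := exists_pt_eq_add P (-k)
    refine ⟨P', Or.inr (Or.inl ?_)⟩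
    rw [h2, hP']
    module

theorem isReducedClass_of_mem_Div0 {D : Divisor d} (hD : D ∈ Div0 d) :
    IsReducedClass (cl d D) := by
  have hdeg : clDegree d (cl d D) = 0 := hD
  obtain ⟨I, hI, p, q, hcl⟩ := exists_cl_eq_idealDiv D
  rw [hcl] at hdeg ⊢
  obtain ⟨a, ha | ha⟩ := (Module.finrank K (Chart d 0 ⧸ I)).even_or_odd'
  · -- In even degree, the point `O` is added to make the degree odd.
    have hm := (prime_asIdeal (ptO d).maxIdeal).ne_zero
    have hfin : Module.finrank K (Chart d 0 ⧸ (ptO d).maxIdeal.asIdeal * I) = 2 * a + 1 := by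
      rw [finrank_quotient_eq_add hm hI, (ptO d).finrank_maxIdeal, ha, add_comm]
    obtain ⟨r, s, h⟩ := cl_idealDiv_of_odd (mul_ne_zero hm hI) hfin
    rw [idealDiv_mul hm hI, (ptO d).idealDiv_maxIdeal, map_add] at h
    change pt (ptO d) + _ = _ ∨ ∃ P, pt (ptO d) + _ = _ at h
    rcases h with h | ⟨P, h⟩
    · have hI' : cl d (idealDiv I) = pt (ptO d) + r • o1 d + (s - 2) • o2 d := by
        rw [eq_sub_of_add_eq' h, sub_smul, ← two_zsmul_pt_O]; module
      rw [hI'] at hdeg ⊢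
      simp only [map_add, map_zsmul, clDegree_pt, clDegree_o1, clDegree_o2, smul_eq_mul] at hdeg
      convert isReducedClass_of_add (P := ptO d) (p := r + p) (q := s - 2 + q) (by omega) using 1
      module
    · rw [eq_sub_of_add_eq' h] at hdeg ⊢
      simp only [map_add, map_sub, map_zsmul, clDegree_pt, clDegree_o1, clDegree_o2,
        smul_eq_mul] at hdeg
      convert isReducedClass_of_sub (P := P) (p := r + p) (q := s + q) (by omega) using 1
      module
  · obtain ⟨r, s, h | ⟨P, h⟩⟩ := cl_idealDiv_of_odd hI ha
    · rw [h] at hdeg ⊢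
      simp only [map_add, map_zsmul, clDegree_o1, clDegree_o2, smul_eq_mul] at hdeg
      convert isReducedClass_of_sub (P := ptO d) (p := r + p) (q := s + q) (by omega) using 1
      module
    · rw [h] at hdeg ⊢
      simp only [map_add, map_zsmul, clDegree_pt, clDegree_o1, clDegree_o2, smul_eq_mul] at hdeg
      convert isReducedClass_of_add (P := P) (p := r + p) (q := s + q) (by omega) using 1
      module

theorem exists_linEquiv {D : Divisor d} (hD : D ∈ Div0 d) : ∃ P : AffinePoint d,
    LinEquiv D (P.toDivisor - (ptO d).toDivisor) ∨
    LinEquiv D ((P.toDivisor - (ptO d).toDivisor) + (divOmega1 d - (ptO d).toDivisor)) ∨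
    LinEquiv D ((P.toDivisor - (ptO d).toDivisor) + (divOmega2 d - (ptO d).toDivisor)) ∨
    LinEquiv D ((P.toDivisor - (ptO d).toDivisor) + (divOmega1 d - divOmega2 d)) := by
  obtain ⟨P, h⟩ := isReducedClass_of_mem_Div0 hD
  exact ⟨P, h.imp linEquiv_of_cl_eq
    (Or.imp linEquiv_of_cl_eq (Or.imp linEquiv_of_cl_eq linEquiv_of_cl_eq))⟩

theorem linEquiv_two_nsmul_divOmega1 :
    LinEquiv (2 • divOmega1 d) ((ptO' d).toDivisor + (ptO d).toDivisor) := by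
  refine linEquiv_of_cl_eq ?_
  rw [map_nsmul, map_add, add_comm]
  exact ((pt_O_add_pt_O' (d := d)).trans (two_zsmul _ |>.trans (two_nsmul _).symm)).symm

theorem linEquiv_two_nsmul_divOmega2 :
    LinEquiv (2 • divOmega2 d) ((ptH' d).toDivisor + (ptH d).toDivisor) := by
  refine linEquiv_of_cl_eq ?_
  rw [map_nsmul, map_add, add_comm]
  exact ((pt_H_add_pt_H' (d := d)).trans (two_zsmul _ |>.trans (two_nsmul _).symm)).symm

end Smooth

/-! ### Parity at infinity -/

/-- The parities of the coefficients of a divisor at `Ω₁` and `Ω₂`. -/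
def parity (d : K) : Divisor d →+ ZMod 2 × ZMod 2 :=
  ((Int.castAddHom (ZMod 2)).comp (Finsupp.applyAddHom .omega1)).prod
    ((Int.castAddHom (ZMod 2)).comp (Finsupp.applyAddHom .omega2))

theorem parity_apply {d : K} (D : Divisor d) :
    parity d D = ((D .omega1 : ZMod 2), (D .omega2 : ZMod 2)) := rfl

theorem parity_toDivisor {d : K} (P : AffinePoint d) : parity d P.toDivisor = 0 := by
  simp [parity_apply, AffinePoint.toDivisor, AffinePoint.toClosedPoint]

theorem parity_divOmega1 (d : K) : parity d (divOmega1 d) = (1, 0) := by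
  simp [parity_apply, divOmega1]

theorem parity_divOmega2 (d : K) : parity d (divOmega2 d) = (0, 1) := by
  simp [parity_apply, divOmega2]

/-- When `d` is not a square, the branches of the curve at each of its two nodes are conjugate, so
the parity map vanishes on principal divisors. -/
theorem parity_eq_zero_of_mem_Princ {d : K} (hd : ¬ IsSquare d) {D : Divisor d}
    (hD : D ∈ Princ d) : parity d D = 0 := by
  have hle : Princ d ≤ (parity d).ker := by
    rw [Princ, AddSubgroup.closure_le]
    rintro D ⟨n, G, H, -, -, -, -, h⟩
    have heven : ∀ a b : ℕ, Even a → Even b → (((a : ℤ) - (b : ℤ) : ℤ) : ZMod 2) = 0 := by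
      intro a b ha hb
      rw [ZMod.intCast_zmod_eq_zero_iff_dvd]
      exact_mod_cast (((Int.even_coe_nat a).2 ha).sub ((Int.even_coe_nat b).2 hb)).two_dvd
    refine Prod.ext ?_ ?_
    · change ((D .omega1 : ℤ) : ZMod 2) = 0
      rw [h]
      exact heven _ _ ((isNode1 d).even_ord hd _) ((isNode1 d).even_ord hd _)
    · change ((D .omega2 : ℤ) : ZMod 2) = 0
      rw [h]
      exact heven _ _ ((isNode2 d).even_ord hd _) ((isNode2 d).even_ord hd _)
  exact hle hD

theorem LinEquiv.parity_eq {d : K} (hd : ¬ IsSquare d) {D D' : Divisor d} (h : LinEquiv D D') :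
    parity d D = parity d D' := by
  rw [← sub_eq_zero, ← map_sub]
  exact parity_eq_zero_of_mem_Princ hd h

/-- The parity map on divisor classes of degree zero. -/
def parityJac {d : K} (hd : ¬ IsSquare d) : Jac d →+ ZMod 2 × ZMod 2 :=
  QuotientAddGroup.lift _ ((parity d).comp (Div0 d).subtype) fun _ hD =>
    parity_eq_zero_of_mem_Princ hd hD

theorem parityJac_surjective {d : K} (hd : ¬ IsSquare d) :
    Function.Surjective (parityJac hd) := by
  have hmem : ∀ {E : Divisor d}, Divisor.degree d E = 1 → E - (ptO d).toDivisor ∈ Div0 d :=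
    fun {E} hE => by
      change Divisor.degree d _ = 0
      rw [map_sub, hE, degree_toDivisor, sub_self]
  let c1 : Jac d := QuotientAddGroup.mk ⟨_, hmem (degree_divOmega1 d)⟩
  let c2 : Jac d := QuotientAddGroup.mk ⟨_, hmem (degree_divOmega2 d)⟩
  have h1 : parityJac hd c1 = (1, 0) := by
    change parity d (_ - _) = _
    rw [map_sub, parity_divOmega1, parity_toDivisor, sub_zero]
  have h2 : parityJac hd c2 = (0, 1) := by
    change parity d (_ - _) = _
    rw [map_sub, parity_divOmega2, parity_toDivisor, sub_zero]
  rintro ⟨a, b⟩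
  refine ⟨a.val • c1 + b.val • c2, ?_⟩
  rw [map_add, map_nsmul, map_nsmul, h1, h2]
  simp

/-- Among the four kinds of reduced divisors, only `P - O` has even coefficients at both points at
infinity. -/
theorem mem_ker_parityJac [NeZero (2 : K)] {d : K} [Fact (d * (d - 1) ≠ 0)] (hd : ¬ IsSquare d)
    (c : Jac d) : c ∈ (parityJac hd).ker ↔ ∃ P : AffinePoint d, c = classOf P := by
  constructor
  · intro hc
    obtain ⟨⟨D, hD⟩, rfl⟩ := QuotientAddGroup.mk_surjective c
    have hpar : parity d D = 0 := hc
    obtain ⟨P, h | h | h | h⟩ := exists_linEquiv hD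
    · refine ⟨P, ?_⟩
      rw [classOf, ← sub_eq_zero, ← QuotientAddGroup.mk_sub, QuotientAddGroup.eq_zero_iff]
      exact h
    all_goals
      have h' := h.parity_eq hd
      rw [hpar] at h'
      simp only [map_add, map_sub, parity_toDivisor, parity_divOmega1, parity_divOmega2] at h'
      exfalso
      revert h'
      decide
  · rintro ⟨P, rfl⟩
    change parity d (_ - _) = 0
    rw [map_sub, parity_toDivisor, parity_toDivisor, sub_zero]

theorem exists_subgroup [NeZero (2 : K)] {d : K} [Fact (d * (d - 1) ≠ 0)] (hd : ¬ IsSquare d) :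
    ∃ J₀ : AddSubgroup (Jac d), (∀ c : Jac d, c ∈ J₀ ↔ ∃ P : AffinePoint d, c = classOf P) ∧
      J₀.index = 4 ∧ Nonempty ((Jac d ⧸ J₀) ≃+ ZMod 2 × ZMod 2) := by
  refine ⟨(parityJac hd).ker, mem_ker_parityJac hd, ?_,
    ⟨QuotientAddGroup.quotientKerEquivOfSurjective _ (parityJac_surjective hd)⟩⟩
  rw [AddSubgroup.index_ker, AddMonoidHom.range_eq_top.2 (parityJac_surjective hd)]
  simp

end Reduction

end Edwards

end

open Edwards in
theorem theorem2p1 {K : Type*} [Field K] (hK : (2 : K) ≠ 0) (d : K) (hd : d * (d - 1) ≠ 0) :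
    (∀ D ∈ Div0 d, ∃ P : AffinePoint d,
      LinEquiv D (P.toDivisor - (ptO d).toDivisor) ∨
      LinEquiv D ((P.toDivisor - (ptO d).toDivisor) + (divOmega1 d - (ptO d).toDivisor)) ∨
      LinEquiv D ((P.toDivisor - (ptO d).toDivisor) + (divOmega2 d - (ptO d).toDivisor)) ∨
      LinEquiv D ((P.toDivisor - (ptO d).toDivisor) + (divOmega1 d - divOmega2 d))) ∧
    (¬ IsSquare d → ∃ J₀ : AddSubgroup (Jac d),
      (∀ c : Jac d, c ∈ J₀ ↔ ∃ P : AffinePoint d, c = classOf P) ∧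
      J₀.index = 4 ∧ Nonempty ((Jac d ⧸ J₀) ≃+ ZMod 2 × ZMod 2)) ∧
    LinEquiv (2 • divOmega1 d) ((ptO' d).toDivisor + (ptO d).toDivisor) ∧
    LinEquiv (2 • divOmega2 d) ((ptH' d).toDivisor + (ptH d).toDivisor) := by
  have : NeZero (2 : K) := ⟨hK⟩
  have : Fact (d * (d - 1) ≠ 0) := ⟨hd⟩
  exact ⟨fun D hD => exists_linEquiv hD, exists_subgroup, linEquiv_two_nsmul_divOmega1,
    linEquiv_two_nsmul_divOmega2⟩
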